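/- For a group $G$ and an integer $n\geqslant 0$, let $G\wr S_n := S_n\ltimes G^n$ denote the wreath product, where the symmetric group $S_n$ on $\{1,\ldots,n\}$ acts on $G^n$ by permuting the coordinates (so $G\wr S_0$ is the trivial group). For $n\geqslant 1$, the natural inclusion $\iota: G\wr S_{n-1}\to G\wr S_n$ extends a permutation of $\{1,\ldots,n-1\}$ by fixing $n$, and extends an element of $G^{n-1}$ to an element of $G^n$ by putting the identity of $G$ in the $n$-th coordinate. Let $H_m(-)$ denote group homology with coefficients in the trivial module $\mathbb{Z}$. Corollary. Let $G$ be any group, and let $m\geqslant 0$ and $n$ be integers with $n>2m$. Then the homomorphism $$\iota_* : H_m(G\wr S_{n-1}) \longrightarrow H_m(G\wr S_n)$$ induced by $\iota$ is an isomorphism. -/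

import Mathlib

universe u

/-- The wreath product `G ≀ S_n = S_n ⋉ G^n`: the symmetric group on the `n`-element set `Fin n`
acts on `G^n = (Fin n → G)` by permuting the coordinates, `(π • g) i = g (π⁻¹ i)`.
For `n = 0` it is the trivial group. -/
abbrev WreathSymm (G : Type u) [Group G] (n : ℕ) : Type u :=
  (Fin n → G) ⋊[(mulAutArrow : Equiv.Perm (Fin n) →* MulAut (Fin n → G))] Equiv.Perm (Fin n)

/-- The natural inclusion `G ≀ S_k → G ≀ S_n` for `k ≤ n`: a permutation of the first `k` points is
extended by fixing the remaining points, a tuple in `G^k` is extended by `1` to a tuple in `G^n`. -/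
noncomputable def WreathSymm.incl (G : Type u) [Group G] {k n : ℕ} (h : k ≤ n) :
    WreathSymm G k →* WreathSymm G n :=
  SemidirectProduct.map
    (Function.ExtendByOne.hom G (Fin.castLE h))
    (Equiv.Perm.viaEmbeddingHom (Fin.castLEEmb h))
    (by
      intro π
      ext g a
      change Function.extend (Fin.castLE h) (fun i => g (π⁻¹ i)) 1 a =
        Function.extend (Fin.castLE h) g 1
          ((Equiv.Perm.viaEmbeddingHom (Fin.castLEEmb h) π)⁻¹ a)
      rw [← map_inv]
      generalize π⁻¹ = σ
      have hinj := Fin.castLE_injective h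
      by_cases ha : ∃ i, Fin.castLE h i = a
      · obtain ⟨i, rfl⟩ := ha
        have hi : Equiv.Perm.viaEmbeddingHom (Fin.castLEEmb h) σ (Fin.castLE h i) =
            Fin.castLE h (σ i) :=
          Equiv.Perm.viaEmbedding_apply σ (Fin.castLEEmb h) i
        rw [hi, hinj.extend_apply, hinj.extend_apply]
      · have hi : Equiv.Perm.viaEmbeddingHom (Fin.castLEEmb h) σ a = a :=
          Equiv.Perm.viaEmbedding_apply_of_notMem σ (Fin.castLEEmb h) a
            (by rintro ⟨i, hi⟩; exact ha ⟨i, hi⟩)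
        rw [hi, Function.extend_apply' _ _ _ ha, Function.extend_apply' _ _ _ ha])

/-- The integral homology `H_m(G) = H_m(G; ℤ)`, with trivial action on `ℤ`. Mathlib's
`groupHomology` wants the coefficient ring in the universe of the group, so `ℤ` appears as its copy
`ULift ℤ` there. -/
noncomputable abbrev integralHomology (G : Type u) [Group G] (m : ℕ) :
    ModuleCat.{u} (ULift.{u} ℤ) :=
  groupHomology (Rep.trivial (ULift.{u} ℤ) G (ULift.{u} ℤ)) m

/-- The map `f_* : H_m(G) → H_m(H)` induced by a group homomorphism `f : G → H`
(with the identity map on the coefficients `ℤ`). -/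
noncomputable abbrev integralHomologyMap {G H : Type u} [Group G] [Group H] (f : G →* H) (m : ℕ) :
    integralHomology G m ⟶ integralHomology H m :=
  groupHomology.map f
    (CategoryTheory.CategoryStruct.id (Rep.trivial (ULift.{u} ℤ) G (ULift.{u} ℤ))) m

/-! Write W_n for `G ≀ S_n`. Let C_p be the free module on the injective words of length p: words in
`Fin n × G` whose letters lie over distinct points. The differential C_{p+1} → C_p is the
alternating sum of the deletions of a letter, and C_0 is spanned by the empty word. This complex is
exact in degrees below n (`InjectiveWord.exists_diff_eq`). The group W_n permutes the words of
length p transitively with stabilizer W_{n-p}, so Shapiro's lemma identifies H_q(W_n; C_p) with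
H_q(W_{n-p}) (`isIso_shapiro`). The p+1 faces of a word of length p+1 are translates of each other
by elements centralizing its stabilizer, and inner automorphisms act trivially on homology. Hence
the differential C_{p+1} → C_p induces an alternating sum of p+1 equal maps: zero for odd p, the
stabilization map for even p (`shapiro_comp_wordDiff`).

In place of a spectral sequence, the complex is cut into short exact sequences Z_{p+1} → C_{p+1} →
Z_p, where Z_p is the image of the differential in C_p. Stability in degrees up to q forces H_q(Z_p)
= 0 for odd p and injectivity of H_q(Z_p) → H_q(C_p) for even p, in a range where each homological
degree costs two points (`boundaries_homology`). Applied to Z_1 and Z_2, this makes H_{q+1}(C_1) →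
H_{q+1}(Z_0) an isomorphism. Since Z_0 = C_0, this is stability in degree q+1. -/

namespace groupHomology

open CategoryTheory Finsupp

variable {k H W : Type u} [CommRing k] [Group H] [Group W]

/-! ### Acyclicity of summands of induced modules -/

section Acyclic

lemma cons_contractNth_succ {n : ℕ} (j : Fin (n + 1)) (c : H) (g : Fin (n + 1) → H) :
    (Fin.contractNth j.succ (· * ·) (Fin.cons c g : Fin (n + 2) → H)) =
      Fin.cons c (Fin.contractNth j (· * ·) g) := by
  ext i
  refine Fin.cases ?_ (fun i => ?_) i
  · simp [Fin.contractNth]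
  · simp [Fin.contractNth]

/-- The degree-raising map on inhomogeneous chains attached to a decomposition
`a = ∑ c, (E a) c` of the elements of a representation. -/
noncomputable def decompHomotopy (A : Rep.{u} k H) (E : A.V →ₗ[k] (H →₀ A.V)) (n : ℕ) :
    ((Fin n → H) →₀ A.V) →ₗ[k] ((Fin (n + 1) → H) →₀ A.V) :=
  lsum k fun g => (lsum k fun c : H => lsingle (Fin.cons c⁻¹ g) ∘ₗ A.ρ c⁻¹) ∘ₗ E

lemma decompHomotopy_single (A : Rep.{u} k H) (E : A.V →ₗ[k] (H →₀ A.V)) (n : ℕ)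
    (g : Fin n → H) (a : A.V) :
    decompHomotopy A E n (single g a) =
      (lsum k fun c : H => lsingle (R := k) (Fin.cons c⁻¹ g : Fin (n + 1) → H) ∘ₗ A.ρ c⁻¹) (E a) := by
  simp [decompHomotopy]

/-- The face of the new chain that drops the new entry c⁻¹ restores the summands of a, which add up
to a. The face multiplying c⁻¹ into `g 0` cancels against the first face of the old chain by
equivariance of E. The remaining faces cancel in pairs by the index shift. -/
lemma decompHomotopy_spec (A : Rep.{u} k H) (E : A.V →ₗ[k] (H →₀ A.V))
    (hsum : ∀ a, (E a).sum (fun _ b => b) = a)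
    (hE : ∀ h a, E (A.ρ h a) = ((E a).mapRange (A.ρ h) (map_zero _)).mapDomain (h * ·)) (n : ℕ)
    (x : (Fin (n + 1) → H) →₀ A.V) :
    (inhomogeneousChains.d A (n + 1)).hom (decompHomotopy A E (n + 1) x) +
      decompHomotopy A E n ((inhomogeneousChains.d A n).hom x) = x := by
  induction x using Finsupp.induction_linear with
  | zero => simp
  | add x y hx hy =>
    simp only [map_add]
    nth_rewrite 3 [← hx]
    nth_rewrite 3 [← hy]
    abel
  | single g a =>
    -- With E a replaced by an arbitrary v, both sides are additive in v and a single summand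
    -- suffices.
    have key : ∀ v : H →₀ A.V,
        (inhomogeneousChains.d A (n + 1)).hom ((lsum k fun c : H =>
          lsingle (R := k) (Fin.cons c⁻¹ g : Fin (n + 2) → H) ∘ₗ A.ρ c⁻¹) v) +
        ((lsum k fun c : H => lsingle (R := k) (Fin.cons c⁻¹ (fun i => g i.succ) : Fin (n + 1) → H)
            ∘ₗ A.ρ c⁻¹) ((v.mapRange (A.ρ (g 0)⁻¹) (map_zero _)).mapDomain ((g 0)⁻¹ * ·)) +
          ∑ j : Fin (n + 1), (-1 : k) ^ ((j : ℕ) + 1) •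
            (lsum k fun c : H => lsingle (R := k)
              (Fin.cons c⁻¹ (Fin.contractNth j (· * ·) g) : Fin (n + 1) → H) ∘ₗ A.ρ c⁻¹) v) =
        single g (v.sum fun _ b => b) := by
      intro v
      induction v using Finsupp.induction_linear with
      | zero => simp
      | add v w hv hw =>
        rw [Finsupp.sum_add_index' (fun _ => rfl) (fun _ _ _ => rfl), single_add, ← hv, ← hw]
        simp only [map_add, Finsupp.mapRange_add (map_add _), Finsupp.mapDomain_add, smul_add,
          Finset.sum_add_distrib]
        abel
      | single c b =>
        simp only [lsum_single, LinearMap.comp_apply, lsingle_apply, mapRange_single,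
          mapDomain_single, sum_single_index]
        rw [inhomogeneousChains.d_single, Fin.sum_univ_succ]
        simp only [cons_contractNth_succ]
        have h0 : (Fin.contractNth 0 (· * ·) (Fin.cons c⁻¹ g : Fin (n + 2) → H)) =
            Fin.cons ((g 0)⁻¹ * c)⁻¹ (fun i => g i.succ) := by
          ext i
          refine Fin.cases ?_ (fun i => ?_) i <;> simp [Fin.contractNth]
        rw [h0]
        simp [← Module.End.mul_apply, ← map_mul, pow_succ, Finset.sum_neg_distrib]
        abel
    rw [decompHomotopy_single, inhomogeneousChains.d_single, map_add, map_sum]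
    simp only [map_smul, decompHomotopy_single, hE]
    rw [key, hsum]

/-- The hypotheses say that E is an equivariant section of the sum map from `H →₀ A` with the
diagonal action, so A is a summand of an induced module; E yields a contracting homotopy in positive
degrees. -/
lemma isZero_of_decomposition (A : Rep.{u} k H) (E : A.V →ₗ[k] (H →₀ A.V))
    (hsum : ∀ a, (E a).sum (fun _ b => b) = a)
    (hE : ∀ h a, E (A.ρ h a) = ((E a).mapRange (A.ρ h) (map_zero _)).mapDomain (h * ·)) (n : ℕ) :
    Limits.IsZero (groupHomology A (n + 1)) := by
  refine HomologicalComplex.ExactAt.isZero_homology ?_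
  rw [HomologicalComplex.exactAt_iff' _ (n + 2) (n + 1) n (by simp) (by simp),
    ShortComplex.moduleCat_exact_iff]
  intro x hx
  refine ⟨decompHomotopy A E (n + 1) x, ?_⟩
  have h := decompHomotopy_spec A E hsum hE n x
  have hx' : (inhomogeneousChains.d A n).hom x = 0 := by
    rw [← inhomogeneousChains.d_def]; exact hx
  rw [hx', map_zero, add_zero, ← inhomogeneousChains.d_def] at h
  exact h

end Acyclic

end groupHomology

namespace groupHomology

open CategoryTheory Finsupp

variable {k H W : Type u} [CommRing k] [Group H] [Group W]

/-! ### Permutation coefficients and free presentations -/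

section Coefficients

/-- The diagonal action on the module `X →₀ V` for a `W`-set `X` and a representation `V`. -/
noncomputable def finsuppAction (X : Type u) [MulAction W X] {V : Type u} [AddCommGroup V]
    [Module k V] (ρ : Representation k W V) : Representation k W (X →₀ V) where
  toFun w := mapRange.linearMap (ρ w) ∘ₗ lmapDomain V k (w • ·)
  map_one' := by ext; simp
  map_mul' a b := by ext; simp [mul_smul]

@[simp]
lemma finsuppAction_single (X : Type u) [MulAction W X] {V : Type u} [AddCommGroup V]
    [Module k V] (ρ : Representation k W V) (w : W) (x : X) (b : V) :
    finsuppAction X ρ w (single x b) = single (w • x) (ρ w b) := by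
  simp [finsuppAction]

/-- The module `X →₀ B` with the diagonal action. -/
noncomputable abbrev finsuppRep (X : Type u) [MulAction W X] (B : Rep.{u} k W) : Rep.{u} k W :=
  Rep.of (finsuppAction X B.ρ)

/-- The module `W →₀ B`, on which `W` acts by left multiplication on itself only. -/
noncomputable abbrev freeRep (B : Rep.{u} k W) : Rep.{u} k W :=
  Rep.of (finsuppAction W (Representation.trivial k W B.V))

/-- The map of representations on `X →₀ _` induced by a map of coefficients. -/
noncomputable abbrev finsuppRepMap (X : Type u) [MulAction W X] {A B : Rep.{u} k W} (f : A ⟶ B) :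
    finsuppRep X A ⟶ finsuppRep X B :=
  Rep.ofHom ⟨mapRange.linearMap f.hom.toLinearMap, fun w => by
    ext x b : 2
    simp [Rep.hom_comm_apply]⟩

variable (k) in
/-- The functor `B ↦ (X →₀ B)` on representations. -/
noncomputable abbrev finsuppRepFunctor (X : Type u) [MulAction W X] :
    Rep.{u} k W ⥤ Rep.{u} k W where
  obj := finsuppRep X
  map := finsuppRepMap X
  map_id A := Rep.hom_ext (Representation.IntertwiningMap.ext
    (by ext : 2; simp))
  map_comp {A B C} f g := Rep.hom_ext (Representation.IntertwiningMap.ext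
    (by ext : 2; simp))

instance (X : Type u) [MulAction W X] :
    (finsuppRepFunctor k (W := W) X).PreservesZeroMorphisms where
  map_zero A B := Rep.hom_ext (Representation.IntertwiningMap.ext
    (by ext : 2; simp))

/-- The surjection of a free representation onto a given one. -/
noncomputable abbrev freeRepCounit (B : Rep.{u} k W) : freeRep B ⟶ B :=
  Rep.ofHom (σ := B.ρ) ⟨lsum k (fun w : W => B.ρ w), fun w => by
    ext x b : 2
    simp⟩

lemma freeRepCounit_surjective (B : Rep.{u} k W) :
    Function.Surjective (freeRepCounit B).hom := fun b =>
  ⟨(single 1 b : W →₀ B.V), by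
    change lsum k (fun w : W => B.ρ w) (single 1 b) = b
    simp⟩

lemma exact_iff (S : ShortComplex (Rep.{u} k W)) :
    S.Exact ↔ ∀ x, S.g.hom x = 0 → ∃ y, S.f.hom y = x := by
  rw [← ShortComplex.exact_map_iff_of_faithful S (forget₂ (Rep.{u} k W) (ModuleCat.{u} k)),
    ShortComplex.moduleCat_exact_iff]
  rfl

lemma shortExact_iff (S : ShortComplex (Rep.{u} k W)) :
    S.ShortExact ↔ Function.Injective S.f.hom ∧
      (∀ x, S.g.hom x = 0 → ∃ y, S.f.hom y = x) ∧ Function.Surjective S.g.hom := by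
  constructor
  · intro h
    exact ⟨(Rep.mono_iff_injective _).1 h.mono_f, (exact_iff S).1 h.exact,
      (Rep.epi_iff_surjective _).1 h.epi_g⟩
  · rintro ⟨h₁, h₂, h₃⟩
    exact { exact := (exact_iff S).2 h₂, mono_f := (Rep.mono_iff_injective _).2 h₁,
            epi_g := (Rep.epi_iff_surjective _).2 h₃ }

lemma finsuppRep_shortExact (X : Type u) [MulAction W X] {S : ShortComplex (Rep.{u} k W)}
    (hS : S.ShortExact) : (S.map (finsuppRepFunctor k X)).ShortExact := by
  rw [shortExact_iff] at hS ⊢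
  obtain ⟨h₁, h₂, h₃⟩ := hS
  refine ⟨?_, fun (x : X →₀ S.X₂.V) hx => ?_, ?_⟩
  · exact mapRange_injective (α := X) S.f.hom (map_zero _) h₁
  · have hx' : ∀ i, S.g.hom (x i) = 0 := fun i => DFunLike.congr_fun (F := X →₀ S.X₃.V) hx i
    choose! s hs using h₂
    classical
    -- The chosen preimage of 0 may be nonzero, so it is replaced by 0 to keep the support finite.
    refine ⟨Finsupp.onFinset x.support (fun i => if x i = 0 then 0 else s (x i)) (fun i hi => by
        by_contra h; simp at h; simp [h] at hi), Finsupp.ext (α := X) (M := S.X₂.V) fun i => ?_⟩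
    change S.f.hom (if x i = 0 then 0 else s (x i)) = x i
    split_ifs with h
    · rw [map_zero, h]
    · exact hs _ (hx' i)
  · exact mapRange_surjective (α := X) S.g.hom (map_zero _) h₃

/-- The presentation of a representation by a free one. -/
noncomputable abbrev freeCover (B : Rep.{u} k W) : ShortComplex (Rep.{u} k W) :=
  ShortComplex.mk (Limits.kernel.ι (freeRepCounit B)) (freeRepCounit B) (by simp)

lemma freeCover_shortExact (B : Rep.{u} k W) : (freeCover B).ShortExact where
  exact := ShortComplex.exact_kernel _
  epi_g := (Rep.epi_iff_surjective _).2 (freeRepCounit_surjective B)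

/-- Free representations stay acyclic on subgroups. -/
lemma isZero_res_freeRep {j : H →* W} (hj : Function.Injective j) (B : Rep.{u} k W) (n : ℕ) :
    Limits.IsZero (groupHomology (Rep.res j (freeRep B)) (n + 1)) := by
  -- With a representative chosen in each right coset of the image of H, γ w is the H-component of
  -- w. Grading the free module by γ gives the required decomposition.
  obtain ⟨γ, hγ⟩ : ∃ γ : W → H, ∀ h w, γ (j h * w) = h * γ w := by
    let r : Setoid W := QuotientGroup.rightRel j.range
    have hr : ∀ w : W, ∃ h : H, j h * (Quotient.mk r w).out = w := fun w => by
      have h := Quotient.mk_out (s := r) w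
      rw [QuotientGroup.rightRel_apply] at h
      obtain ⟨h, hh⟩ := h
      exact ⟨h, by rw [hh]; simp⟩
    choose γ hγ using hr
    refine ⟨γ, fun h w => hj ?_⟩
    have e : Quotient.mk r (j h * w) = Quotient.mk r w :=
      Quotient.sound (QuotientGroup.rightRel_apply.2 ⟨h⁻¹, by simp⟩)
    have h1 := hγ (j h * w)
    rw [e] at h1
    apply mul_right_cancel (b := (Quotient.mk r w).out)
    rw [h1, map_mul, mul_assoc, hγ]
  refine isZero_of_decomposition (Rep.res j (freeRep B))
    (lsum k fun w : W => lsingle (γ w) ∘ₗ lsingle (R := k) w) (fun a => ?_) (fun h a => ?_) n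
  · change W →₀ B.V at a
    induction a using Finsupp.induction_linear with
    | zero => rw [map_zero]; exact sum_zero_index
    | add x y hx hy =>
      rw [map_add, Finsupp.sum_add_index' (fun _ => rfl) (fun _ _ _ => rfl), hx, hy]
    | single w b => simp
  · change W →₀ B.V at a
    induction a using Finsupp.induction_linear with
    | zero => simp
    | add x y hx hy =>
      simp only [map_add, Finsupp.mapRange_add (map_add _), Finsupp.mapDomain_add, hx, hy]
    | single w b => simp [hγ]

lemma isZero_freeRep (B : Rep.{u} k W) (n : ℕ) :
    Limits.IsZero (groupHomology (freeRep B) (n + 1)) :=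
  isZero_res_freeRep (j := MonoidHom.id W) Function.injective_id B n

/-- The basis is indexed by X × W with W translating its own factor, so grading by that factor is
equivariant whatever the action on X. -/
lemma isZero_finsuppRep_freeRep (X : Type u) [MulAction W X] (B : Rep.{u} k W) (n : ℕ) :
    Limits.IsZero (groupHomology (finsuppRep X (freeRep B)) (n + 1)) := by
  let E : (X →₀ (W →₀ B.V)) →ₗ[k] (W →₀ (X →₀ (W →₀ B.V))) := lsum k fun x : X =>
    lsum k fun w : W => lsingle w ∘ₗ lsingle (R := k) x ∘ₗ lsingle (R := k) w
  have hE : ∀ x w b, E (single x (single w b)) = single w (single x (single w b)) := fun x w b => by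
    rw [lsum_single, lsum_single]
    rfl
  refine isZero_of_decomposition (finsuppRep X (freeRep B)) E (fun a => ?_) (fun h a => ?_) n
  · change X →₀ (W →₀ B.V) at a
    induction a using Finsupp.induction_linear with
    | zero => rw [map_zero]; exact sum_zero_index
    | add x y hx hy =>
      rw [map_add, Finsupp.sum_add_index' (fun _ => rfl) (fun _ _ _ => rfl), hx, hy]
    | single x v =>
      induction v using Finsupp.induction_linear with
      | zero => rw [single_zero, map_zero]; exact sum_zero_index
      | add x y hx hy =>
        rw [single_add, map_add, Finsupp.sum_add_index' (fun _ => rfl) (fun _ _ _ => rfl), hx, hy]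
      | single w b => simp [hE]
  · change X →₀ (W →₀ B.V) at a
    induction a using Finsupp.induction_linear with
    | zero => simp
    | add x y hx hy =>
      simp only [map_add, Finsupp.mapRange_add (map_add _), Finsupp.mapDomain_add, hx, hy]
    | single x v =>
      induction v using Finsupp.induction_linear with
      | zero => simp
      | add x y hx hy =>
        simp only [single_add, map_add, Finsupp.mapRange_add (map_add _), Finsupp.mapDomain_add,
          hx, hy]
      | single w b => simp [hE]

end Coefficients

end groupHomology

namespace groupHomology

open CategoryTheory Finsupp

variable {k H W : Type u} [CommRing k] [Group H] [Group W]

/-! ### Dimension shifting -/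

section DimensionShifting

lemma chainsMap_comp_chainsMap_id {A A' : Rep.{u} k H} {B B' : Rep.{u} k W} (f : H →* W)
    (φ : A ⟶ Rep.res f B) (φ' : A' ⟶ Rep.res f B') (α : A ⟶ A') (β : B ⟶ B')
    (h : ∀ a, β.hom (φ.hom a) = φ'.hom (α.hom a)) :
    chainsMap f φ ≫ chainsMap (MonoidHom.id W) β =
      chainsMap (MonoidHom.id H) α ≫ chainsMap f φ' := by
  rw [← chainsMap_comp, ← chainsMap_comp]
  exact chainsMap_congr rfl (LinearMap.ext h)

lemma mono_δ_of_isZero_homology {S : ShortComplex (ChainComplex (ModuleCat.{u} k) ℕ)}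
    (hS : S.ShortExact) (q : ℕ) (h : Limits.IsZero (S.X₂.homology (q + 1))) :
    Mono (hS.δ (q + 1) q rfl) :=
  (hS.homology_exact₃ (q + 1) q rfl).mono_g (h.eq_of_src _ _)

/-- In each row the connecting map identifies the homology of X₃ in degree q+1 with the kernel of
H_q(X₁) → H_q(X₂). An isomorphism on H_q(X₁) and a monomorphism on H_q(X₂) identify these kernels.
-/
lemma isIso_homologyMap_τ₃_of_isZero {S₁ S₂ : ShortComplex (ChainComplex (ModuleCat.{u} k) ℕ)}
    (φ : S₁ ⟶ S₂) (hS₁ : S₁.ShortExact) (hS₂ : S₂.ShortExact) (q : ℕ)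
    (h₁ : Limits.IsZero (S₁.X₂.homology (q + 1))) (h₂ : Limits.IsZero (S₂.X₂.homology (q + 1)))
    [IsIso (HomologicalComplex.homologyMap φ.τ₁ q)]
    [Mono (HomologicalComplex.homologyMap φ.τ₂ q)] :
    IsIso (HomologicalComplex.homologyMap φ.τ₃ (q + 1)) := by
  have m₁ := mono_δ_of_isZero_homology hS₁ q h₁
  have m₂ := mono_δ_of_isZero_homology hS₂ q h₂
  have nat := HomologicalComplex.HomologySequence.δ_naturality φ hS₁ hS₂ (q + 1) q rfl
  have hm : Mono (HomologicalComplex.homologyMap φ.τ₃ (q + 1)) := by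
    have : Mono (HomologicalComplex.homologyMap φ.τ₃ (q + 1) ≫ hS₂.δ (q + 1) q rfl) := by
      rw [← nat]; infer_instance
    exact mono_of_mono _ (hS₂.δ (q + 1) q rfl)
  let s : S₂.X₃.homology (q + 1) ⟶ S₁.X₃.homology (q + 1) :=
    (hS₁.homology_exact₁ (q + 1) q rfl).lift
      (hS₂.δ (q + 1) q rfl ≫ inv (HomologicalComplex.homologyMap φ.τ₁ q)) (by
        rw [← cancel_mono (HomologicalComplex.homologyMap φ.τ₂ q)]
        have e : HomologicalComplex.homologyMap S₁.f q ≫ HomologicalComplex.homologyMap φ.τ₂ q =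
            HomologicalComplex.homologyMap φ.τ₁ q ≫ HomologicalComplex.homologyMap S₂.f q := by
          rw [← HomologicalComplex.homologyMap_comp, ← φ.comm₁₂,
            HomologicalComplex.homologyMap_comp]
        dsimp
        rw [Category.assoc, e, Category.assoc, IsIso.inv_hom_id_assoc, Limits.zero_comp]
        exact hS₂.δ_comp (q + 1) q rfl)
  have hs : s ≫ hS₁.δ (q + 1) q rfl =
      hS₂.δ (q + 1) q rfl ≫ inv (HomologicalComplex.homologyMap φ.τ₁ q) :=
    (hS₁.homology_exact₁ (q + 1) q rfl).lift_f _ _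
  have hsec : s ≫ HomologicalComplex.homologyMap φ.τ₃ (q + 1) = 𝟙 _ := by
    rw [← cancel_mono (hS₂.δ (q + 1) q rfl), Category.assoc, ← nat, reassoc_of% hs,
      IsIso.inv_hom_id, Category.comp_id, Category.id_comp]
  have : IsSplitEpi (HomologicalComplex.homologyMap φ.τ₃ (q + 1)) := ⟨⟨⟨s, hsec⟩⟩⟩
  exact isIso_of_mono_of_isSplitEpi _

end DimensionShifting

/-! ### Triviality of inner automorphisms -/

section Conjugation

/-- The action of `w` as a morphism from a representation to its conjugate by `w`. -/
noncomputable abbrev conjHom (w : W) (A : Rep.{u} k W) :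
    A ⟶ Rep.res (MulAut.conj w).toMonoidHom A :=
  Rep.ofHom (ρ := A.ρ) (σ := A.ρ.comp (MulAut.conj w).toMonoidHom) ⟨A.ρ w, fun g => by
    ext a
    simp⟩

lemma H0π_ρ (A : Rep.{u} k W) (w : W) (a : A.V) : H0π A (A.ρ w a) = H0π A a := by
  apply (ModuleCat.mono_iff_injective (H0Iso A).hom).1 inferInstance
  have h := fun x => congr($(H0π_comp_H0Iso_hom A) x)
  exact ((h _).trans (Representation.Coinvariants.mk_self_apply A.ρ w a)).trans (h _).symm

/-- Inner automorphisms act trivially on group homology. -/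
theorem map_conj (w : W) (q : ℕ) (A : Rep.{u} k W) :
    map (MulAut.conj w).toMonoidHom (conjHom w A) q = 𝟙 _ := by
  induction q generalizing A with
  | zero =>
    rw [← cancel_epi (H0π A), H0π_comp_map, Category.comp_id]
    ext a
    exact H0π_ρ A w a
  | succ q ih =>
    -- The connecting map of the free presentation is injective and commutes with conjugation, so
    -- the claim descends to the kernel in degree q.
    have hS := map_chainsFunctor_shortExact (freeCover_shortExact A)
    have m := mono_δ_of_isZero_homology hS q (isZero_freeRep A q)
    let φ : (freeCover A).map (chainsFunctor k W) ⟶ (freeCover A).map (chainsFunctor k W) :=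
      { τ₁ := chainsMap (MulAut.conj w).toMonoidHom (conjHom w _)
        τ₂ := chainsMap (MulAut.conj w).toMonoidHom (conjHom w _)
        τ₃ := chainsMap (MulAut.conj w).toMonoidHom (conjHom w _)
        comm₁₂ := by
          exact chainsMap_comp_chainsMap_id _ _ _ _ _ fun a => Rep.hom_comm_apply (freeCover A).f w a
        comm₂₃ := by
          exact chainsMap_comp_chainsMap_id _ _ _ _ _ fun a => Rep.hom_comm_apply (freeCover A).g w a }
    have nat := HomologicalComplex.HomologySequence.δ_naturality φ hS hS (q + 1) q rfl
    refine m.right_cancellation _ _ ?_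
    refine nat.symm.trans ?_
    have := ih (freeCover A).X₁
    refine (congrArg (hS.δ (q + 1) q rfl ≫ ·) this).trans ?_
    exact (Category.comp_id _).trans (Category.id_comp _).symm

end Conjugation

/-! ### Shapiro's lemma -/

section Shapiro

variable {X : Type u} [MulAction W X]

/-- For a point `x` fixed by `H`, the inclusion `b ↦ b·x` of coefficients. -/
noncomputable abbrev singleHom (j : H →* W) (x : X) (hx : ∀ h, j h • x = x) (B : Rep.{u} k W) :
    Rep.res j B ⟶ Rep.res j (finsuppRep X B) :=
  Rep.ofHom (ρ := B.ρ.comp j) (σ := (finsuppAction X B.ρ).comp j) ⟨lsingle x, fun h => by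
    ext b
    simp [hx]⟩

/-- Shapiro's lemma for a transitive `W`-set `X` and a group mapping isomorphically onto the
stabilizer of a point. -/
theorem isIso_map_singleHom {j : H →* W} (hj : Function.Injective j) (x : X)
    (hx : ∀ h, j h • x = x) (hstab : ∀ w : W, w • x = x → w ∈ j.range)
    (htrans : ∀ y : X, ∃ w : W, w • x = y) (q : ℕ) (B : Rep.{u} k W) :
    IsIso (map j (singleHom j x hx B) q) := by
  induction q generalizing B with
  | zero =>
    choose s hs using htrans
    -- The inverse on coinvariants: b placed at y is the translate by s y of (s y)⁻¹ b placed at x.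
    -- Another choice of s y changes the value by an element of H, which is invisible in H_0.
    let r : (X →₀ B.V) →ₗ[k] groupHomology (Rep.res j B) 0 :=
      lsum k fun y => (H0π (Rep.res j B)).hom ∘ₗ B.ρ (s y)⁻¹
    have hr : ∀ w y b, r (single (w • y) (B.ρ w b)) = r (single y b) := fun w y b => by
      obtain ⟨h, hh⟩ := hstab ((s y)⁻¹ * w⁻¹ * s (w • y)) (by
        rw [mul_smul, mul_smul, hs, inv_smul_smul, inv_smul_eq_iff, hs])
      have e : (s y)⁻¹ = j h * (s (w • y))⁻¹ * w := by rw [hh]; group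
      simp only [r, lsum_single, LinearMap.comp_apply]
      rw [e, map_mul, map_mul, Module.End.mul_apply, Module.End.mul_apply]
      exact (H0π_ρ (Rep.res j B) h _).symm
    have hc : ∀ w : W, r ∘ₗ finsuppAction X B.ρ w = r := fun w => by
      ext y b : 2
      simpa using hr w y b
    let R : (finsuppRep X B).ρ.Coinvariants →ₗ[k] groupHomology (Rep.res j B) 0 :=
      Representation.Coinvariants.lift _ r hc
    let inv' : groupHomology (finsuppRep X B) 0 ⟶ groupHomology (Rep.res j B) 0 :=
      (H0Iso (finsuppRep X B)).hom ≫ ModuleCat.ofHom R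
    have hinv : ∀ v : X →₀ B.V, inv' (H0π (finsuppRep X B) v) = r v := fun v => by
      have h := congr($(H0π_comp_H0Iso_hom (finsuppRep X B)) v)
      exact congrArg R h
    have hmap : ∀ b, map j (singleHom j x hx B) 0 (H0π _ b) =
        H0π (finsuppRep X B) (single x b) := fun b => congr($(H0π_comp_map j (singleHom j x hx B)) b)
    -- The chosen s x need not be 1, but it lies in the stabilizer.
    have h1 : s x • x = x := hs x
    have hrx : ∀ b, r (single x b) = H0π (Rep.res j B) b := fun b => by
      obtain ⟨h, hh⟩ := hstab _ h1
      simp only [r, lsum_single, LinearMap.comp_apply]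
      rw [← hh, ← map_inv]
      exact H0π_ρ (Rep.res j B) h⁻¹ b
    refine ⟨inv', ?_, ?_⟩
    · rw [← cancel_epi (H0π _)]
      ext b
      exact (congrArg inv' (hmap b)).trans ((hinv _).trans (hrx b))
    · rw [← cancel_epi (H0π _)]
      ext1
      refine lhom_ext (α := X) (M := B.V) fun y b => ?_
      have e1 : inv' (H0π (finsuppRep X B) (single y b)) = H0π (Rep.res j B) (B.ρ (s y)⁻¹ b) := by
        rw [hinv]
        simp [r]
      have e2 := H0π_ρ (finsuppRep X B) (s y) (single x (B.ρ (s y)⁻¹ b))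
      rw [finsuppAction_single, hs] at e2
      refine (congrArg (map j (singleHom j x hx B) 0) e1).trans ((hmap _).trans ?_)
      refine e2.symm.trans ?_
      simp
  | succ q ih =>
    have hS := freeCover_shortExact B
    have hS₁ := map_chainsFunctor_shortExact ((Rep.shortExact_res j).2 hS)
    have hS₂ := map_chainsFunctor_shortExact (finsuppRep_shortExact X hS)
    let φ : ((freeCover B).map (Rep.resFunctor j)).map (chainsFunctor k H) ⟶
        ((freeCover B).map (finsuppRepFunctor k X)).map (chainsFunctor k W) :=
      { τ₁ := chainsMap j (singleHom j x hx _)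
        τ₂ := chainsMap j (singleHom j x hx _)
        τ₃ := chainsMap j (singleHom j x hx _)
        comm₁₂ := chainsMap_comp_chainsMap_id _ _ _ _ _ fun a =>
          mapRange_single (hf := map_zero (freeCover B).f.hom.toLinearMap)
        comm₂₃ := chainsMap_comp_chainsMap_id _ _ _ _ _ fun a =>
          mapRange_single (hf := map_zero (freeCover B).g.hom.toLinearMap) }
    have i1 : IsIso (HomologicalComplex.homologyMap φ.τ₁ q) := ih _
    -- The middle terms also need the inductive hypothesis, because for q = 0 their homology need
    -- not vanish.
    have i2 : IsIso (HomologicalComplex.homologyMap φ.τ₂ q) := ih _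
    exact isIso_homologyMap_τ₃_of_isZero φ hS₁ hS₂ q (isZero_res_freeRep hj B q)
      (isZero_finsuppRep_freeRep X B q)

end Shapiro

end groupHomology

namespace groupHomology

open CategoryTheory Finsupp

variable {k H W : Type u} [CommRing k] [Group H] [Group W]

/-! ### Maps on homology given by fixed vectors -/

section FixedVectors

/-- The map of coefficients `c ↦ c • y` determined by an `H`-fixed vector `y`. -/
noncomputable abbrev fixedHom (j : H →* W) (B : Rep.{u} k W) (y : B.V)
    (hy : ∀ h, B.ρ (j h) y = y) : Rep.trivial k H k ⟶ Rep.res j B :=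
  Rep.ofHom (ρ := Representation.trivial k H k) (σ := B.ρ.comp j)
    ⟨LinearMap.toSpanSingleton k B.V y, fun h => by
      ext
      simp [hy]⟩

lemma homologyMap_chainsMap_add {A : Rep.{u} k H} {B : Rep.{u} k W} (j : H →* W)
    (φ ψ : A ⟶ Rep.res j B) (q : ℕ) : map j (φ + ψ) q = map j φ q + map j ψ q := by
  have e : chainsMap j (φ + ψ) = chainsMap j φ + chainsMap j ψ := by
    ext n g a : 5
    simp [chainsMap_f, Rep.add_hom]
  exact (congrArg (HomologicalComplex.homologyMap · q) e).trans
    (HomologicalComplex.homologyMap_add (chainsMap j φ) (chainsMap j ψ) q)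

/-- Conjugation by w leaves j unchanged and carries y to w y, while acting as the identity on
homology. -/
lemma map_fixedHom_conj (j : H →* W) (B : Rep.{u} k W) (y : B.V) (hy : ∀ h, B.ρ (j h) y = y)
    (w : W) (hw : ∀ h, Commute w (j h)) (y' : B.V) (hy' : ∀ h, B.ρ (j h) y' = y')
    (hyy' : y' = B.ρ w y) (q : ℕ) :
    map j (fixedHom j B y' hy') q = map j (fixedHom j B y hy) q := by
  rw [← Category.comp_id (map j (fixedHom j B y hy) q), ← map_conj w q B, ← map_comp]
  refine map_congr (MonoidHom.ext fun h => ?_) ?_ q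
  · change _ = w * j h * w⁻¹
    rw [(hw h).eq, mul_inv_cancel_right]
  · subst hyy'
    refine LinearMap.ext_ring ?_
    change (1 : k) • B.ρ w y = B.ρ w ((1 : k) • y)
    rw [one_smul, one_smul]

lemma map_fixedHom_comp_functor_map (j : H →* W) {B B' : Rep.{u} k W} (f : B ⟶ B') (y : B.V)
    (hy : ∀ h, B.ρ (j h) y = y) (y' : B'.V) (hy' : ∀ h, B'.ρ (j h) y' = y') (hyy' : f.hom y = y')
    (q : ℕ) :
    map j (fixedHom j B y hy) q ≫ (functor k W q).map f = map j (fixedHom j B' y' hy') q := by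
  subst hyy'
  refine (map_comp j (MonoidHom.id W) (fixedHom j B y hy) f q).symm.trans ?_
  refine map_congr (MonoidHom.id_comp j) (LinearMap.ext_ring ?_) q
  change f.hom ((1 : k) • y) = (1 : k) • f.hom y
  rw [one_smul, one_smul]

lemma map_trivial_comp_map_fixedHom {K : Type u} [Group K] (i : K →* H) (j : H →* W) (l : K →* W)
    (hl : ∀ a, j (i a) = l a) (B : Rep.{u} k W) (y : B.V) (hy : ∀ h, B.ρ (j h) y = y)
    (hy' : ∀ h, B.ρ (l h) y = y) (q : ℕ) :
    map (B := Rep.trivial k H k) i (𝟙 (Rep.trivial k K k)) q ≫ map j (fixedHom j B y hy) q =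
      map l (fixedHom l B y hy') q := by
  obtain rfl : j.comp i = l := MonoidHom.ext hl
  refine (map_comp (B := Rep.trivial k H k) i j (𝟙 (Rep.trivial k K k))
    (fixedHom j B y hy) q).symm.trans ?_
  rfl

/-- The induced map is additive in the fixed vector, so equal contributions f with alternating signs
cancel in pairs. -/
lemma map_fixedHom_alternating_sum (j : H →* W) (B : Rep.{u} k W) (y : ℕ → B.V) (p : ℕ) (q : ℕ)
    (hy : ∀ i < p, ∀ h, B.ρ (j h) (y i) = y i)
    (f : groupHomology (Rep.trivial k H k) q ⟶ groupHomology B q)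
    (hf : ∀ i (hi : i < p), map j (fixedHom j B (y i) (hy i hi)) q = f)
    (z : B.V) (hz : ∀ h, B.ρ (j h) z = z)
    (hsum : z = ∑ i ∈ Finset.range p, (-1 : k) ^ i • y i) :
    map j (fixedHom j B z hz) q = if Even p then 0 else f := by
  induction p generalizing z with
  | zero =>
    rw [Finset.sum_range_zero] at hsum
    subst hsum
    have : fixedHom j B 0 hz = 0 := by
      ext
      simp
    rw [this, map, chainsMap_zero, if_pos Even.zero]
    exact HomologicalComplex.homologyMap_zero _ _ _
  | succ p ih =>
    rw [Finset.sum_range_succ] at hsum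
    set z₁ := ∑ i ∈ Finset.range p, (-1 : k) ^ i • y i with hz₁
    have hz₁' : ∀ h, B.ρ (j h) z₁ = z₁ := fun h => by
      simp only [hz₁, map_sum, map_smul]
      exact Finset.sum_congr rfl fun i hi => by
        rw [hy i ((Finset.mem_range.1 hi).trans p.lt_succ_self)]
    have h1 := ih (fun i hi => hy i (hi.trans p.lt_succ_self))
      (fun i hi => hf i (hi.trans p.lt_succ_self)) z₁ hz₁' rfl
    have h2 := hf p p.lt_succ_self
    rcases Nat.even_or_odd p with hp | hp
    · have hp' : ¬ Even (p + 1) := by simpa [Nat.even_add_one] using hp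
      rw [if_neg hp', ← h2]
      rw [if_pos hp] at h1
      have : fixedHom j B z hz = fixedHom j B z₁ hz₁' + fixedHom j B (y p) (hy p p.lt_succ_self) := by
        ext
        simp [hsum, hp.neg_one_pow, Rep.add_hom]
      rw [this, homologyMap_chainsMap_add, h1, zero_add]
    · have hp' : Even (p + 1) := by simpa [Nat.even_add_one] using hp
      rw [if_pos hp']
      rw [if_neg (Nat.not_even_iff_odd.2 hp), ← h2] at h1
      have : fixedHom j B z₁ hz₁' = fixedHom j B z hz + fixedHom j B (y p) (hy p p.lt_succ_self) := by
        ext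
        simp [hsum, hp.neg_one_pow, Rep.add_hom]
      rw [this, homologyMap_chainsMap_add] at h1
      exact add_eq_right.1 h1

lemma isIso_map_fixedHom {X : Type u} [MulAction W X] {j : H →* W} (hj : Function.Injective j)
    (x : X) (hx : ∀ h, j h • x = x) (hstab : ∀ w : W, w • x = x → w ∈ j.range)
    (htrans : ∀ y : X, ∃ w : W, w • x = y) (q : ℕ)
    (hx' : ∀ h, (finsuppRep X (Rep.trivial k W k)).ρ (j h) (single x 1) = single x 1) :
    IsIso (map j (fixedHom j (finsuppRep X (Rep.trivial k W k)) (single x 1) hx') q) := by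
  have := isIso_map_singleHom hj x hx hstab htrans q (Rep.trivial k W k)
  have e : map j (fixedHom j (finsuppRep X (Rep.trivial k W k)) (single x 1) hx') q =
      map j (singleHom j x hx (Rep.trivial k W k)) q := by
    refine map_congr (A := Rep.trivial k H k) rfl ?_ q
    refine LinearMap.ext_ring ?_
    change (1 : k) • (single x 1 : X →₀ k) = single x 1
    rw [one_smul]
  rw [e]
  exact this

/-- Homology in degree zero with trivial coefficients does not depend on the group. -/
lemma isIso_map_zero_trivial (j : H →* W) :
    IsIso (map (B := Rep.trivial k W k) j (𝟙 (Rep.trivial k H k)) 0) := by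
  have e := H0π_comp_map (B := Rep.trivial k W k) j (𝟙 (Rep.trivial k H k))
  have h1 : IsIso (H0π (Rep.trivial k H k)) := by
    rw [← H0IsoOfIsTrivial_inv_eq_π]; infer_instance
  have h2 : IsIso (H0π (Rep.trivial k W k)) := by
    rw [← H0IsoOfIsTrivial_inv_eq_π]; infer_instance
  have e' : map (B := Rep.trivial k W k) j (𝟙 (Rep.trivial k H k)) 0 =
      inv (H0π (Rep.trivial k H k)) ≫ H0π (Rep.trivial k W k) := by
    rw [IsIso.eq_inv_comp, e]
    rfl
  rw [e']
  infer_instance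

end FixedVectors

end groupHomology

/-! ### Exactness of the complex of injective words -/

namespace InjectiveWord

open Finsupp

variable {k : Type*} [CommRing k] {L P : Type*} [DecidableEq P] (pt : L → P)

variable (k) in
/-- The alternating sum of the words obtained from `w` by deleting a letter over `S`; the signs
count all letters. -/
noncomputable def deletions (S : Finset P) : List L → (List L →₀ k)
  | [] => 0
  | l :: w => (if pt l ∈ S then single w 1 else 0) - mapDomain (l :: ·) (deletions S w)

variable (k) in
/-- The differential on the free module on words deleting letters over `S`. -/
noncomputable def diff (S : Finset P) : (List L →₀ k) →ₗ[k] (List L →₀ k) :=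
  linearCombination k (deletions k pt S)

@[simp]
lemma diff_single (S : Finset P) (w : List L) (c : k) :
    diff k pt S (single w c) = c • deletions k pt S w := by
  simp [diff]

/-- For a letter over S this makes prepending a contracting homotopy; on injective words it is
usable only where the point of that letter is absent. -/
lemma diff_cons (S : Finset P) (l : L) (x : List L →₀ k) :
    diff k pt S (lmapDomain k k (l :: ·) x) =
      (if pt l ∈ S then x else 0) - lmapDomain k k (l :: ·) (diff k pt S x) := by
  induction x using Finsupp.induction_linear with
  | zero => simp
  | add x y hx hy =>
    simp only [map_add, hx, hy]
    split_ifs <;> abel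
  | single w c =>
    simp only [lmapDomain_apply, mapDomain_single, diff_single, deletions, smul_sub,
      ← mapDomain_smul]
    split_ifs <;> simp

lemma diff_diff (S : Finset P) (x : List L →₀ k) : diff k pt S (diff k pt S x) = 0 := by
  suffices h : ∀ w, diff k pt S (deletions k pt S w) = 0 by
    induction x using Finsupp.induction_linear with
    | zero => simp
    | add x y hx hy => simp [hx, hy]
    | single w c => simp [h]
  intro w
  induction w with
  | nil => simp [deletions]
  | cons l w ih =>
    rw [deletions, map_sub, ← lmapDomain_apply k k, diff_cons, ih]
    split_ifs <;> simp

lemma diff_insert {S : Finset P} {a : P} (ha : a ∉ S) (x : List L →₀ k) :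
    diff k pt (insert a S) x = diff k pt S x + diff k pt {a} x := by
  suffices h : ∀ w, deletions k pt (insert a S) w = deletions k pt S w + deletions k pt {a} w by
    induction x using Finsupp.induction_linear with
    | zero => simp
    | add x y hx hy => simp only [map_add, hx, hy]; abel
    | single w c => simp [h]
  intro w
  induction w with
  | nil => simp [deletions]
  | cons l w ih =>
    simp only [deletions, ih, mapDomain_add, Finset.mem_insert, Finset.mem_singleton]
    by_cases h1 : pt l = a
    · have : pt l ∉ S := h1 ▸ ha
      simp only [h1, ha, true_or, if_true, if_false]
      abel
    · simp only [h1, false_or, if_false]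
      abel

lemma map_mem_of_supported {M : Type*} [AddCommGroup M] [Module k M] {α : Type*} {s : Set α}
    {N : Submodule k M} (f : (α →₀ k) →ₗ[k] M) (hf : ∀ a ∈ s, f (single a 1) ∈ N) {x : α →₀ k}
    (hx : x ∈ supported k k s) : f x ∈ N := by
  rw [supported_eq_span_single] at hx
  have : Submodule.span k ((fun i => single i (1 : k)) '' s) ≤ N.comap f := by
    rw [Submodule.span_le]
    rintro _ ⟨a, ha, rfl⟩
    exact hf a ha
  exact this hx

lemma deletions_mem (S : Finset P) (w : List L) :
    deletions k pt S w ∈ supported k k {v | ∃ l, pt l ∈ S ∧ w.Perm (l :: v)} := by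
  induction w with
  | nil => exact Submodule.zero_mem _
  | cons l w ih =>
    refine Submodule.sub_mem _ ?_ ?_
    · split_ifs with h
      · exact single_mem_supported _ _ ⟨l, h, List.Perm.refl _⟩
      · exact Submodule.zero_mem _
    · refine map_mem_of_supported (lmapDomain k k (l :: ·)) ?_ ih
      rintro v ⟨l', h, hv⟩
      rw [lmapDomain_apply, mapDomain_single]
      exact single_mem_supported _ _ ⟨l', h, (hv.cons l).trans (List.Perm.swap _ _ _)⟩

/-- If every word obtained by deleting from a word in `A` a letter over `S` is in `B`, the
differential maps the span of `A` to the span of `B`. -/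
lemma diff_mem (S : Finset P) {A B : Set (List L)}
    (h : ∀ w ∈ A, ∀ l v, pt l ∈ S → w.Perm (l :: v) → v ∈ B) {x : List L →₀ k}
    (hx : x ∈ supported k k A) : diff k pt S x ∈ supported k k B := by
  refine map_mem_of_supported (diff k pt S) (fun w hw => ?_) hx
  rw [diff_single, one_smul]
  refine supported_mono ?_ (deletions_mem pt S w)
  rintro v ⟨l, hl, hv⟩
  exact h w hw l v hl hv

lemma lmapDomain_cons_mem (l : L) {A B : Set (List L)} (h : ∀ w ∈ A, l :: w ∈ B) {x : List L →₀ k}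
    (hx : x ∈ supported k k A) : lmapDomain k k (l :: ·) x ∈ supported k k B := by
  refine map_mem_of_supported _ (fun w hw => ?_) hx
  rw [lmapDomain_apply, mapDomain_single]
  exact single_mem_supported _ _ (h w hw)

/-- The injective words of length `p` over `S ∪ T` that use all points of `T`. -/
def words (S T : Finset P) (p : ℕ) : Set (List L) :=
  {w | (w.map pt).Nodup ∧ (∀ x ∈ w.map pt, x ∈ S ∨ x ∈ T) ∧ (∀ t ∈ T, t ∈ w.map pt) ∧ w.length = p}

variable {pt}

/-- The complex of injective words is exact below the top degree. -/
theorem exists_diff_eq (sec : P → L) (hsec : ∀ a, pt (sec a) = a) (S : Finset P) :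
    ∀ (T : Finset P) (_ : Disjoint S T) (p : ℕ) (_ : p < S.card + T.card) (z : List L →₀ k)
      (_ : z ∈ supported k k (words pt S T p)) (_ : diff k pt S z = 0),
      ∃ y ∈ supported k k (words pt S T (p + 1)), diff k pt S y = z := by
  induction S using Finset.induction_on with
  | empty =>
    -- An injective word over T using all of T has length |T| > p, so there are no words.
    intro T _ p hp z hz _
    have : words (L := L) pt ∅ T p = ∅ := by
      refine Set.eq_empty_of_forall_notMem fun w ⟨h1, h2, h3, h4⟩ => ?_
      have : T = (w.map pt).toFinset := by
        ext x
        simp only [List.mem_toFinset]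
        exact ⟨h3 x, fun h => by simpa using h2 x h⟩
      rw [this, List.toFinset_card_of_nodup h1] at hp
      simp [h4] at hp
    rw [this, supported_empty, Submodule.mem_bot] at hz
    exact ⟨0, Submodule.zero_mem _, by simp [hz]⟩
  | insert a S ha ih =>
    intro T hT p hp z hz hdz
    rw [Finset.disjoint_insert_left] at hT
    obtain ⟨haT, hST⟩ := hT
    classical
    -- The cone with apex `sec a`, to be applied only to words avoiding a.
    set c : (List L →₀ k) →ₗ[k] (List L →₀ k) := lmapDomain k k (sec a :: ·) with hc
    have hdc : ∀ x, diff k pt (insert a S) (c x) = x - c (diff k pt (insert a S) x) := fun x => by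
      rw [hc, diff_cons, hsec, if_pos (Finset.mem_insert_self _ _)]
    have hsub₀ : ∀ p, words (L := L) pt S T p ⊆ {w | a ∉ w.map pt} := fun p w hw h =>
      (hw.2.1 a h).elim ha haT
    have hsub : ∀ p, words (L := L) pt S (insert a T) p ⊆ words pt (insert a S) T p := fun p w hw =>
      ⟨hw.1, fun x hx => by
        have := hw.2.1 x hx
        simp only [Finset.mem_insert] at this ⊢
        tauto, fun t ht => hw.2.2.1 t (Finset.mem_insert_of_mem ht), hw.2.2.2⟩
    have hcons : ∀ p, ∀ w ∈ words (L := L) pt S T p, sec a :: w ∈ words pt S (insert a T) (p + 1) :=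
      fun p w hw => by
        refine ⟨?_, ?_, ?_, by simp [hw.2.2.2]⟩
        · rw [List.map_cons, List.nodup_cons, hsec]
          exact ⟨hsub₀ p hw, hw.1⟩
        · intro x hx
          rw [List.map_cons, List.mem_cons, hsec] at hx
          rcases hx with rfl | hx
          · simp
          · have := hw.2.1 x hx
            simp only [Finset.mem_insert]
            tauto
        · intro t ht
          rw [List.map_cons, List.mem_cons, hsec]
          rcases Finset.mem_insert.1 ht with rfl | ht
          · exact Or.inl rfl
          · exact Or.inr (hw.2.2.1 t ht)
    have hcx : ∀ p {x : List L →₀ k}, x ∈ supported k k (words pt S T p) →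
        c x ∈ supported k k (words pt S (insert a T) (p + 1)) := fun p x hx =>
      lmapDomain_cons_mem _ (hcons p) hx
    have hperm : ∀ p (w : List L), w ∈ words pt S T p → ∀ l v, pt l ∈ S → w.Perm (l :: v) →
        v ∈ words pt S T v.length ∧ v.length + 1 = p := fun p w hw l v hl hv => by
      have hv' := hv.map pt
      rw [List.map_cons] at hv'
      have hnd := hv'.nodup_iff.1 hw.1
      rw [List.nodup_cons] at hnd
      refine ⟨⟨hnd.2, fun x hx => hw.2.1 x (hv'.mem_iff.2 (List.mem_cons_of_mem _ hx)),
        fun t ht => ?_, rfl⟩, ?_⟩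
      · rcases List.mem_cons.1 (hv'.mem_iff.1 (hw.2.2.1 t ht)) with rfl | h
        · exact absurd ht (Finset.disjoint_left.1 hST hl)
        · exact h
      · rw [← hw.2.2.2, hv.length_eq, List.length_cons]
    -- the part of `z` made of words avoiding `a`
    set z₀ := z.filter fun w => a ∉ w.map pt with hz₀
    set z₁ := z.filter fun w => ¬ a ∉ w.map pt with hz₁
    have hz01 : z₀ + z₁ = z := filter_add_filter_not z _
    have hz₀m : z₀ ∈ supported k k (words pt S T p) := fun w hw => by
      simp only [hz₀, support_filter, Finset.coe_filter, Set.mem_ofPred_eq] at hw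
      have h := hz hw.1
      refine ⟨h.1, fun x hx => ?_, h.2.2⟩
      have := h.2.1 x hx
      rw [Finset.mem_insert] at this
      rcases this with (rfl | h) | h
      · exact absurd hx hw.2
      · exact Or.inl h
      · exact Or.inr h
    have hz₁m : z₁ ∈ supported k k (words pt S (insert a T) p) := fun w hw => by
      simp only [hz₁, support_filter, Finset.coe_filter, Set.mem_ofPred_eq, not_not] at hw
      have h := hz hw.1
      refine ⟨h.1, fun x hx => ?_, fun t ht => ?_, h.2.2.2⟩
      · have := h.2.1 x hx
        simp only [Finset.mem_insert] at this ⊢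
        tauto
      · rcases Finset.mem_insert.1 ht with rfl | ht
        · exact hw.2
        · exact h.2.2.1 t ht
    have hda : diff k pt {a} z₀ = 0 := by
      have := diff_mem pt {a} (B := ∅) (fun w hw l v hl hv => by
        rw [Finset.mem_singleton] at hl
        refine hsub₀ p hw ((hv.map pt).mem_iff.2 ?_)
        simp [hl]) hz₀m
      rwa [supported_empty, Submodule.mem_bot] at this
    -- Subtracting the boundary of c z₀ from z leaves a cycle all of whose words contain a.
    set z' := z₁ + c (diff k pt (insert a S) z₀) with hz'
    have hz'm : z' ∈ supported k k (words pt S (insert a T) p) := by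
      refine Submodule.add_mem _ hz₁m ?_
      rw [diff_insert pt ha, hda, add_zero]
      refine lmapDomain_cons_mem (A := {v | v ∈ words pt S T v.length ∧ v.length + 1 = p}) _
        (fun v hv => hv.2 ▸ hcons _ v hv.1) (diff_mem pt S (hperm p) hz₀m)
    have hzz' : z = diff k pt (insert a S) (c z₀) + z' := by
      rw [hdc, hz', ← hz01]
      abel
    have hdz' : diff k pt (insert a S) z' = 0 := by
      have : z' = z - diff k pt (insert a S) (c z₀) := by rw [hzz']; abel
      rw [this, map_sub, hdz, diff_diff, sub_zero]
    have hremove : ∀ p (w : List L), w ∈ words pt S (insert a T) p → ∀ l v, pt l ∈ ({a} : Finset P) →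
        w.Perm (l :: v) → v ∈ words pt S T v.length ∧ v.length + 1 = p := fun p w hw l v hl hv => by
      rw [Finset.mem_singleton] at hl
      have hv' := hv.map pt
      rw [List.map_cons, hl] at hv'
      have hnd := hv'.nodup_iff.1 hw.1
      rw [List.nodup_cons] at hnd
      refine ⟨⟨hnd.2, fun x hx => ?_, fun t ht => ?_, rfl⟩, ?_⟩
      · have h := hw.2.1 x (hv'.mem_iff.2 (List.mem_cons_of_mem _ hx))
        rw [Finset.mem_insert] at h
        rcases h with h | rfl | h
        · exact Or.inl h
        · exact absurd hx hnd.1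
        · exact Or.inr h
      · rcases List.mem_cons.1 (hv'.mem_iff.1 (hw.2.2.1 t (Finset.mem_insert_of_mem ht))) with rfl | h
        · exact absurd ht haT
        · exact h
      · rw [← hw.2.2.2, hv.length_eq, List.length_cons]
    -- The two parts of the differential of z' cannot cancel: deletions over S keep a, the deletion
    -- of a removes it. So each part vanishes, and induction applies with a moved from S to T.
    have hdS : diff k pt S z' = 0 := by
      have h1 : diff k pt S z' ∈ supported k k {v : List L | a ∈ v.map pt} :=
        diff_mem pt S (fun w hw l v hl hv => by
          have h := (hv.map pt).mem_iff.1 (hw.2.2.1 a (Finset.mem_insert_self _ _))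
          rw [List.map_cons, List.mem_cons] at h
          rcases h with rfl | h
          · exact absurd hl ha
          · exact h) hz'm
      have h2 : diff k pt {a} z' ∈ supported k k {v : List L | a ∉ v.map pt} :=
        diff_mem pt {a} (fun w hw l v hl hv => hsub₀ _ (hremove p w hw l v hl hv).1) hz'm
      rw [diff_insert pt ha] at hdz'
      have h3 : diff k pt S z' ∈ supported k k {v : List L | a ∉ v.map pt} := by
        rw [eq_neg_of_add_eq_zero_left hdz']
        exact Submodule.neg_mem _ h2
      have hd : Disjoint {v : List L | a ∈ v.map pt} {v : List L | a ∉ v.map pt} :=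
        Set.disjoint_left.2 fun v h h' => h' h
      exact Submodule.disjoint_def.1 (disjoint_supported_supported hd) _ h1 h3
    obtain ⟨y, hy, hyz⟩ := ih (insert a T) (by
        rw [Finset.disjoint_insert_right]; exact ⟨ha, hST⟩) p (by
        rw [Finset.card_insert_of_notMem ha] at hp
        rw [Finset.card_insert_of_notMem haT]
        omega) z' hz'm hdS
    -- The primitive y of z' for deletions over S has an error x under the full differential. It is
    -- a cycle avoiding a, hence the boundary of c x.
    set x := diff k pt {a} y with hx
    have hxm : x ∈ supported k k (words pt S T p) := diff_mem pt {a} (fun w hw l v hl hv => by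
      obtain ⟨h1, h2⟩ := hremove _ w hw l v hl hv
      rwa [Nat.add_right_cancel h2] at h1) hy
    have hyx : diff k pt (insert a S) y = z' + x := by rw [diff_insert pt ha, hyz]
    have hdx : diff k pt (insert a S) x = 0 := by
      have : x = diff k pt (insert a S) y - z' := by rw [hyx]; abel
      rw [this, map_sub, diff_diff, hdz', sub_zero]
    refine ⟨c z₀ + (y - c x), ?_, ?_⟩
    · exact supported_mono (hsub _) (Submodule.add_mem _ (hcx p hz₀m)
        (Submodule.sub_mem _ hy (hcx p hxm)))
    · rw [map_add, map_sub, hyx, hdc x, hdx, map_zero, sub_zero, add_sub_cancel_right, ← hzz']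

end InjectiveWord

/-! ### The wreath product and its inclusions -/

namespace WreathSymm

open Finsupp

variable {G : Type u} [Group G] {n : ℕ}

/-- The action of the wreath product on pairs of a point and a group element. -/
def act (a : WreathSymm G n) (l : Fin n × G) : Fin n × G :=
  (a.right l.1, a.left (a.right l.1) * l.2)

lemma act_one (l : Fin n × G) : act (1 : WreathSymm G n) l = l := by
  simp [act]

lemma act_mul (a b : WreathSymm G n) (l : Fin n × G) : act (a * b) l = act a (act b l) := by
  refine Prod.ext rfl ?_
  change (a.left * fun i => b.left (a.right⁻¹ i)) (a.right (b.right l.1)) * l.2 = _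
  simp [act, mul_assoc]

section Incl

variable {m : ℕ} (h : m ≤ n)

lemma incl_right_castLE (a : WreathSymm G m) (i : Fin m) :
    (incl G h a).right (Fin.castLE h i) = Fin.castLE h (a.right i) :=
  Equiv.Perm.viaEmbedding_apply a.right (Fin.castLEEmb h) i

lemma incl_left_castLE (a : WreathSymm G m) (i : Fin m) :
    (incl G h a).left (Fin.castLE h i) = a.left i :=
  (Fin.castLE_injective h).extend_apply _ _ _

lemma ne_castLE {i : Fin n} (hi : m ≤ i) : ¬ ∃ j : Fin m, Fin.castLE h j = i := by
  rintro ⟨j, rfl⟩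
  exact absurd hi (by simp)

lemma incl_right_of_le (a : WreathSymm G m) {i : Fin n} (hi : m ≤ i) :
    (incl G h a).right i = i :=
  Equiv.Perm.viaEmbedding_apply_of_notMem a.right (Fin.castLEEmb h) i fun ⟨j, hj⟩ =>
    ne_castLE h hi ⟨j, hj⟩

lemma incl_left_of_le (a : WreathSymm G m) {i : Fin n} (hi : m ≤ i) :
    (incl G h a).left i = 1 :=
  Function.extend_apply' _ _ _ (ne_castLE h hi)

lemma exists_castLE_or_le (i : Fin n) : (∃ j : Fin m, Fin.castLE h j = i) ∨ m ≤ i := by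
  rcases lt_or_ge (i : ℕ) m with hi | hi
  · exact Or.inl ⟨⟨i, hi⟩, rfl⟩
  · exact Or.inr hi

lemma ext_apply {a b : WreathSymm G n} (hl : ∀ i, a.left i = b.left i)
    (hr : ∀ i, a.right i = b.right i) : a = b :=
  SemidirectProduct.ext (funext hl) (Equiv.ext hr)

lemma incl_injective : Function.Injective (incl G h) := fun a b hab => by
  refine ext_apply (fun i => ?_) (fun i => ?_)
  · rw [← incl_left_castLE h, hab, incl_left_castLE]
  · apply Fin.castLE_injective h
    rw [← incl_right_castLE h, hab, incl_right_castLE]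

lemma mem_range_incl {b : WreathSymm G n} (hl : ∀ i : Fin n, m ≤ i → b.left i = 1)
    (hr : ∀ i : Fin n, m ≤ i → b.right i = i) : b ∈ (incl G h).range := by
  have key : ∀ (π : Equiv.Perm (Fin n)), (∀ i : Fin n, m ≤ i → π i = i) → ∀ j : Fin m,
      (π (Fin.castLE h j) : ℕ) < m := fun π hπ j => by
    by_contra hlt
    rw [not_lt] at hlt
    have := π.injective (hπ _ hlt)
    rw [this] at hlt
    exact absurd hlt (by simp)
  have hr' : ∀ i : Fin n, m ≤ i → b.right⁻¹ i = i := fun i hi => by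
    rw [Equiv.Perm.inv_eq_iff_eq, hr i hi]
  let π : Equiv.Perm (Fin m) :=
    { toFun := fun j => ⟨b.right (Fin.castLE h j), key _ hr j⟩
      invFun := fun j => ⟨b.right⁻¹ (Fin.castLE h j), key _ hr' j⟩
      left_inv := fun j => Fin.ext (by
        change ((b.right⁻¹ (b.right (Fin.castLE h j)) : Fin n) : ℕ) = j
        simp)
      right_inv := fun j => Fin.ext (by
        change ((b.right (b.right⁻¹ (Fin.castLE h j)) : Fin n) : ℕ) = j
        simp) }
  refine ⟨⟨fun j => b.left (Fin.castLE h j), π⟩, ext_apply (fun i => ?_) (fun i => ?_)⟩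
  · rcases exists_castLE_or_le h i with ⟨j, rfl⟩ | hi
    · rw [incl_left_castLE]
    · rw [incl_left_of_le h _ hi, hl i hi]
  · rcases exists_castLE_or_le h i with ⟨j, rfl⟩ | hi
    · rw [incl_right_castLE]
      rfl
    · rw [incl_right_of_le h _ hi, hr i hi]

lemma incl_incl {l : ℕ} (h' : l ≤ m) (a : WreathSymm G l) :
    incl G h (incl G h' a) = incl G (h'.trans h) a := by
  have e : ∀ i : Fin l, Fin.castLE h (Fin.castLE h' i) = Fin.castLE (h'.trans h) i := fun i => rfl
  refine ext_apply (fun i => ?_) (fun i => ?_) <;>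
  rcases exists_castLE_or_le h i with ⟨j, rfl⟩ | hi
  · rw [incl_left_castLE]
    rcases exists_castLE_or_le h' j with ⟨r, rfl⟩ | hj
    · rw [incl_left_castLE, e, incl_left_castLE]
    · rw [incl_left_of_le h' _ hj, incl_left_of_le _ _ (by simpa using hj)]
  · rw [incl_left_of_le h _ hi, incl_left_of_le _ _ (h'.trans hi)]
  · rw [incl_right_castLE]
    rcases exists_castLE_or_le h' j with ⟨r, rfl⟩ | hj
    · rw [incl_right_castLE, e, e, incl_right_castLE]
    · rw [incl_right_of_le h' _ hj, incl_right_of_le _ _ (by simpa using hj)]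
  · rw [incl_right_of_le h _ hi, incl_right_of_le _ _ (h'.trans hi)]

lemma commute_swap_incl (a : WreathSymm G m) {x y : Fin n} (hx : m ≤ x) (hy : m ≤ y) :
    Commute (SemidirectProduct.inr (Equiv.swap x y) : WreathSymm G n) (incl G h a) := by
  refine SemidirectProduct.ext (funext fun i => ?_) ?_
  · change (1 : Fin n → G) i * (incl G h a).left ((Equiv.swap x y)⁻¹ i) = (incl G h a).left i * 1
    rw [Pi.one_apply, one_mul, mul_one, Equiv.swap_inv]
    rcases eq_or_ne i x with rfl | hix
    · rw [Equiv.swap_apply_left, incl_left_of_le h a hx, incl_left_of_le h a hy]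
    rcases eq_or_ne i y with rfl | hiy
    · rw [Equiv.swap_apply_right, incl_left_of_le h a hx, incl_left_of_le h a hy]
    rw [Equiv.swap_apply_of_ne_of_ne hix hiy]
  · change Equiv.swap x y * (incl G h a).right = (incl G h a).right * Equiv.swap x y
    rw [Equiv.mul_swap_eq_swap_mul, incl_right_of_le h a hx, incl_right_of_le h a hy]

end Incl

/-! ### The action on injective words -/

variable (G n) in
/-- Words of length `p` in `Fin n × G` whose letters lie over distinct points. -/
@[ext]
structure Word (p : ℕ) : Type u where
  /-- The letters of the word. -/
  toList : List (Fin n × G)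
  nodup : (toList.map Prod.fst).Nodup
  length_eq : toList.length = p

namespace Word

variable {p : ℕ}

lemma toList_injective : Function.Injective (toList : Word G n p → _) :=
  fun _ _ => Word.ext

lemma map_fst_act (a : WreathSymm G n) (w : List (Fin n × G)) :
    (w.map (act a)).map Prod.fst = (w.map Prod.fst).map a.right := by
  simp [act, Function.comp_def]

instance : MulAction (WreathSymm G n) (Word G n p) where
  smul a w := ⟨w.toList.map (act a), by
    rw [map_fst_act]; exact w.nodup.map a.right.injective, by rw [List.length_map, w.length_eq]⟩
  one_smul w := Word.ext ((List.map_congr_left fun l _ => act_one l).trans (List.map_id _))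
  mul_smul a b w := Word.ext (by
    change w.toList.map (act (a * b)) = (w.toList.map (act b)).map (act a)
    rw [List.map_map]
    exact List.map_congr_left fun l _ => act_mul a b l)

lemma smul_toList (a : WreathSymm G n) (w : Word G n p) : (a • w).toList = w.toList.map (act a) := rfl

/-- The word obtained by deleting the letter at position `i` (the last one if `i` is too large). -/
def erase (w : Word G n (p + 1)) (i : ℕ) : Word G n p :=
  ⟨w.toList.eraseIdx (min i p), by
    refine List.Nodup.sublist ?_ w.nodup
    exact (List.eraseIdx_sublist _ _).map _, by
    rw [List.length_eraseIdx_of_lt (by rw [w.length_eq]; omega), w.length_eq, Nat.add_sub_cancel]⟩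

lemma erase_toList (w : Word G n (p + 1)) {i : ℕ} (hi : i < p + 1) :
    (w.erase i).toList = w.toList.eraseIdx i := by
  change w.toList.eraseIdx (min i p) = _
  rw [min_eq_left (Nat.lt_succ_iff.1 hi)]

lemma smul_erase (a : WreathSymm G n) (w : Word G n (p + 1)) (i : ℕ) :
    (a • w).erase i = a • w.erase i :=
  Word.ext (List.eraseIdx_map _ _ _)

/-- The last `p` points of `Fin n`. -/
def lastPoints (n p : ℕ) : List (Fin n) := (List.finRange n).drop (n - p)

lemma lastPoints_nodup (n p : ℕ) : (lastPoints n p).Nodup :=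
  (List.nodup_finRange n).sublist (List.drop_sublist _ _)

lemma length_lastPoints (hp : p ≤ n) : (lastPoints n p).length = p := by
  rw [lastPoints, List.length_drop, List.length_finRange]
  omega

lemma mem_lastPoints {i : Fin n} : i ∈ lastPoints n p ↔ n - p ≤ i := by
  rw [lastPoints, List.mem_drop_iff_getElem]
  constructor
  · rintro ⟨j, hj, rfl⟩
    simp
  · intro hi
    exact ⟨i - (n - p), by simp; omega, by ext; simp; omega⟩

lemma lastPoints_succ (hp : p + 1 ≤ n) :
    ∃ x, lastPoints n (p + 1) = x :: lastPoints n p := by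
  have hlt : n - (p + 1) < (List.finRange n).length := by rw [List.length_finRange]; omega
  refine ⟨(List.finRange n)[n - (p + 1)], ?_⟩
  rw [lastPoints, lastPoints, List.drop_eq_getElem_cons hlt,
    show n - (p + 1) + 1 = n - p by omega]

variable (G) in
/-- The word made of the last `p` points with trivial labels. -/
def base (hp : p ≤ n) : Word G n p :=
  ⟨(lastPoints n p).map fun i => (i, 1), by
    rw [List.map_map]
    exact (List.map_id (lastPoints n p)).symm ▸ lastPoints_nodup n p, by
    rw [List.length_map, length_lastPoints hp]⟩

lemma smul_base_eq_iff (hp : p ≤ n) (b : WreathSymm G n) :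
    b • base G hp = base G hp ↔ ∀ i : Fin n, n - p ≤ i → b.left i = 1 ∧ b.right i = i := by
  refine (⟨fun h => congrArg Word.toList h, Word.ext⟩ : _ ↔
    (b • base G hp).toList = (base G hp).toList).trans ?_
  rw [smul_toList]
  change ((lastPoints n p).map fun i => (i, (1 : G))).map (act b) = (lastPoints n p).map _ ↔ _
  rw [List.map_map, List.map_inj_left]
  refine forall_congr' fun i => ?_
  rw [mem_lastPoints]
  refine imp_congr_right fun _ => ?_
  simp only [act, Function.comp_apply, Prod.mk.injEq, mul_one]
  constructor
  · rintro ⟨h1, h2⟩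
    exact ⟨by rwa [h1] at h2, h1⟩
  · rintro ⟨h1, h2⟩
    exact ⟨h2, by rwa [h2]⟩

lemma incl_smul_base (hp : p ≤ n) (a : WreathSymm G (n - p)) :
    incl G (Nat.sub_le n p) a • base G hp = base G hp :=
  (smul_base_eq_iff hp _).2 fun _ hi => ⟨incl_left_of_le _ a hi, incl_right_of_le _ a hi⟩

lemma mem_range_incl_of_smul_base (hp : p ≤ n) (b : WreathSymm G n)
    (h : b • base G hp = base G hp) : b ∈ (incl G (Nat.sub_le n p)).range := by
  rw [smul_base_eq_iff] at h
  exact mem_range_incl _ (fun i hi => (h i hi).1) (fun i hi => (h i hi).2)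

lemma exists_perm_map_eq {α : Type*} [DecidableEq α] :
    ∀ (s t : List α) (_ : s.Nodup) (_ : t.Nodup) (_ : s.length = t.length),
      ∃ π : Equiv.Perm α, s.map π = t
  | [], [], _, _, _ => ⟨1, rfl⟩
  | x :: s, y :: t, hs, ht, hl => by
    rw [List.nodup_cons] at hs ht
    obtain ⟨π, hπ⟩ := exists_perm_map_eq s t hs.2 ht.2 (by simpa using hl)
    refine ⟨Equiv.swap (π x) y * π, ?_⟩
    rw [List.map_cons]
    congr 1
    · simp
    · rw [← hπ]
      refine List.map_congr_left fun z hz => ?_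
      rw [Equiv.Perm.mul_apply, Equiv.swap_apply_of_ne_of_ne]
      · intro h
        exact hs.1 (π.injective h ▸ hz)
      · intro h
        exact ht.1 (hπ ▸ h ▸ List.mem_map_of_mem hz)

lemma exists_smul_base (hp : p ≤ n) (w : Word G n p) :
    ∃ b : WreathSymm G n, b • base G hp = w := by
  obtain ⟨π, hπ⟩ := exists_perm_map_eq (lastPoints n p) (w.toList.map Prod.fst) (lastPoints_nodup n p)
    w.nodup (by rw [length_lastPoints hp, List.length_map, w.length_eq])
  classical
  -- Labels are read off the word; at points it does not meet any value works, here 1.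
  let g : Fin n → G := fun j => if h : ∃ l ∈ w.toList, l.1 = j then h.choose.2 else 1
  have hg : ∀ l ∈ w.toList, g l.1 = l.2 := fun l hl => by
    have h : ∃ l' ∈ w.toList, l'.1 = l.1 := ⟨l, hl, rfl⟩
    have e : h.choose = l :=
      List.inj_on_of_nodup_map w.nodup h.choose_spec.1 hl h.choose_spec.2
    simp only [g, dif_pos h, e]
  refine ⟨⟨g, π⟩, Word.ext ?_⟩
  rw [smul_toList]
  change ((lastPoints n p).map fun i => (i, (1 : G))).map (act _) = w.toList
  have e : (w.toList.map Prod.fst).map (fun i => (i, g i)) = w.toList := by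
    rw [List.map_map]
    refine (List.map_congr_left fun l hl => ?_).trans (List.map_id _)
    exact Prod.ext rfl (hg l hl)
  rw [← e, ← hπ, List.map_map, List.map_map]
  refine List.map_congr_left fun i _ => ?_
  simp [act]

/-- The two deletions differ only at position i, where one has the old letter i and the other the
old letter i+1; x and y are these letters. -/
lemma exists_eraseIdx_succ_eq {α : Type*} [DecidableEq α] :
    ∀ (i : ℕ) (s : List α) (_ : s.Nodup) (_ : i + 1 < s.length), ∃ x ∈ s, ∃ y ∈ s,
      s.eraseIdx (i + 1) = (s.eraseIdx i).map (Equiv.swap x y)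
  | 0, x :: y :: t, hs, _ => by
    refine ⟨x, by simp, y, by simp, ?_⟩
    simp only [List.nodup_cons, List.mem_cons, not_or] at hs
    simp only [List.eraseIdx_cons_succ, List.eraseIdx_cons_zero, List.map_cons,
      Equiv.swap_apply_right, List.cons.injEq, true_and]
    refine ((List.map_congr_left fun z hz => ?_).trans (List.map_id t)).symm
    exact Equiv.swap_apply_of_ne_of_ne (fun h => hs.1.2 (h ▸ hz)) (fun h => hs.2.1 (h ▸ hz))
  | i + 1, z :: t, hs, hl => by
    rw [List.nodup_cons] at hs
    obtain ⟨x, hx, y, hy, h⟩ := exists_eraseIdx_succ_eq i t hs.2 (by simpa using hl)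
    refine ⟨x, List.mem_cons_of_mem _ hx, y, List.mem_cons_of_mem _ hy, ?_⟩
    rw [List.eraseIdx_cons_succ, List.eraseIdx_cons_succ, List.map_cons, h,
      Equiv.swap_apply_of_ne_of_ne (ne_of_mem_of_not_mem hx hs.1).symm
        (ne_of_mem_of_not_mem hy hs.1).symm]

/-- All faces of the base word agree up to elements commuting with the stabilizer. -/
lemma exists_erase_base_eq (hp : p + 1 ≤ n) (i : ℕ) (hi : i < p + 1) :
    ∃ b : WreathSymm G n, (∀ a, Commute b (incl G (Nat.sub_le n (p + 1)) a)) ∧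
      (base G hp).erase i = b • base G (p.le_succ.trans hp) := by
  induction i with
  | zero =>
    -- Dropping the first of the last p+1 points leaves exactly the last p points.
    refine ⟨1, fun a => Commute.one_left _, ?_⟩
    rw [one_smul]
    apply Word.ext
    rw [erase_toList _ hi]
    obtain ⟨x, hx⟩ := lastPoints_succ hp
    change ((lastPoints n (p + 1)).map _).eraseIdx 0 = (lastPoints n p).map _
    rw [hx]
    rfl
  | succ i ih =>
    obtain ⟨b, hb, hb'⟩ := ih (by omega)
    obtain ⟨x, hx, y, hy, h⟩ := exists_eraseIdx_succ_eq i (lastPoints n (p + 1))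
      (lastPoints_nodup n (p + 1)) (by rw [length_lastPoints hp]; omega)
    rw [mem_lastPoints] at hx hy
    refine ⟨SemidirectProduct.inr (Equiv.swap x y) * b, fun a =>
      (commute_swap_incl _ a hx hy).mul_left (hb a), ?_⟩
    rw [mul_smul, ← hb']
    apply Word.ext
    rw [smul_toList, erase_toList _ hi, erase_toList _ (by omega)]
    change ((lastPoints n (p + 1)).map _).eraseIdx (i + 1) =
      (((lastPoints n (p + 1)).map _).eraseIdx i).map _
    rw [List.eraseIdx_map, List.eraseIdx_map, h, List.map_map, List.map_map]
    refine List.map_congr_left fun z _ => ?_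
    simp [act]

end Word

end WreathSymm

/-! ### The complex of words as representations -/

namespace WreathSymm

open CategoryTheory Finsupp groupHomology

variable {G : Type u} [Group G] {n : ℕ} {k : Type u} [CommRing k]

variable (G n k) in
/-- The permutation representation on the injective words of length `p`. -/
noncomputable abbrev wordRep (p : ℕ) : Rep.{u} k (WreathSymm G n) :=
  finsuppRep (Word G n p) (Rep.trivial k (WreathSymm G n) k)

lemma wordRep_ρ_single {p : ℕ} (a : WreathSymm G n) (w : Word G n p) (c : k) :
    (wordRep G n k p).ρ a (single w c) = single (a • w) c := by
  simp

variable (k) in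
/-- The alternating sum of the faces of an injective word. -/
noncomputable def faces {p : ℕ} (w : Word G n (p + 1)) : Word G n p →₀ k :=
  ∑ i ∈ Finset.range (p + 1), (-1 : k) ^ i • single (w.erase i) 1

variable (G n k) in
/-- The differential of the complex of injective words, as a linear map. -/
noncomputable def wordDiffLinear (p : ℕ) : (Word G n (p + 1) →₀ k) →ₗ[k] (Word G n p →₀ k) :=
  linearCombination k (faces k)

lemma wordDiffLinear_single {p : ℕ} (w : Word G n (p + 1)) (c : k) :
    wordDiffLinear G n k p (single w c) = c • faces k w := by
  simp [wordDiffLinear]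

variable (G n k) in
/-- The differential of the complex of injective words. -/
noncomputable def wordDiff (p : ℕ) : wordRep G n k (p + 1) ⟶ wordRep G n k p :=
  Rep.ofHom ⟨wordDiffLinear G n k p, fun a => by
    refine lhom_ext' fun w => LinearMap.ext_ring ?_
    simp only [LinearMap.comp_apply, lsingle_apply, finsuppAction_single,
      Representation.trivial_apply, wordDiffLinear_single, one_smul, faces,
      map_sum, map_smul, Word.smul_erase]⟩

section Exactness

lemma deletions_univ (w : List (Fin n × G)) :
    InjectiveWord.deletions k Prod.fst (Finset.univ : Finset (Fin n)) w =
      ∑ i ∈ Finset.range w.length, (-1 : k) ^ i • single (w.eraseIdx i) 1 := by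
  induction w with
  | nil => simp [InjectiveWord.deletions]
  | cons l w ih =>
    rw [InjectiveWord.deletions, ih, List.length_cons, Finset.sum_range_succ', ← lmapDomain_apply k k]
    simp only [map_sum, map_smul, lmapDomain_apply, mapDomain_single, Finset.mem_univ, if_true,
      List.eraseIdx_cons_succ, List.eraseIdx_cons_zero, pow_succ, mul_neg, mul_one, neg_smul,
      Finset.sum_neg_distrib, pow_zero, one_smul]
    abel

lemma diff_lmapDomain_toList {p : ℕ} (x : Word G n (p + 1) →₀ k) :
    InjectiveWord.diff k Prod.fst (Finset.univ : Finset (Fin n)) (lmapDomain k k Word.toList x) =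
      lmapDomain k k Word.toList (wordDiffLinear G n k p x) := by
  induction x using Finsupp.induction_linear with
  | zero => simp
  | add x y hx hy => simp only [map_add, hx, hy]
  | single w c =>
    rw [lmapDomain_apply, mapDomain_single, InjectiveWord.diff_single, wordDiffLinear_single,
      map_smul, faces, map_sum, deletions_univ, w.length_eq]
    congr 1
    refine Finset.sum_congr rfl fun i hi => ?_
    rw [map_smul, lmapDomain_apply, mapDomain_single, Word.erase_toList w (Finset.mem_range.1 hi)]

/-- Exactness is applied with every point deletable and none compulsory. Phrasing the cycle
condition on lists covers p = 0, where C_0 is not the source of a `wordDiff`. -/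
lemma exists_wordDiffLinear_eq {p : ℕ} (hp : p < n) (z : Word G n p →₀ k)
    (hz : InjectiveWord.diff k Prod.fst (Finset.univ : Finset (Fin n))
      (lmapDomain k k Word.toList z) = 0) : ∃ y, wordDiffLinear G n k p y = z := by
  have hset : ∀ p, InjectiveWord.words (L := Fin n × G) Prod.fst Finset.univ ∅ p =
      {w | (w.map Prod.fst).Nodup ∧ w.length = p} := fun p => by
    ext w
    simp [InjectiveWord.words]
  obtain ⟨y, hy, hyz⟩ := InjectiveWord.exists_diff_eq (k := k) (L := Fin n × G) (pt := Prod.fst)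
    (fun a => (a, 1)) (fun _ => rfl) Finset.univ ∅ (Finset.disjoint_empty_right _) p
    (by simpa using hp) (lmapDomain k k Word.toList z)
    (InjectiveWord.map_mem_of_supported (s := Set.univ) _ (fun w _ => by
      rw [lmapDomain_apply, mapDomain_single, hset]
      exact single_mem_supported _ _ ⟨w.nodup, w.length_eq⟩) (by simp [Finsupp.supported_univ])) hz
  have hy' : y ∈ LinearMap.range (lmapDomain k k (Word.toList (G := G) (n := n) (p := p + 1))) :=
    InjectiveWord.map_mem_of_supported LinearMap.id (fun w hw => by
      rw [hset] at hw
      exact ⟨single ⟨w, hw.1, hw.2⟩ 1, by rw [lmapDomain_apply, mapDomain_single]; rfl⟩) hy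
  obtain ⟨x, rfl⟩ := hy'
  refine ⟨x, ?_⟩
  rw [diff_lmapDomain_toList] at hyz
  exact mapDomain_injective Word.toList_injective hyz

lemma wordDiffLinear_wordDiffLinear {p : ℕ} (x : Word G n (p + 2) →₀ k) :
    wordDiffLinear G n k p (wordDiffLinear G n k (p + 1) x) = 0 := by
  apply mapDomain_injective (Word.toList_injective)
  rw [mapDomain_zero]
  have h1 := diff_lmapDomain_toList (wordDiffLinear G n k (p + 1) x)
  rw [← diff_lmapDomain_toList x, InjectiveWord.diff_diff] at h1
  exact h1.symm

lemma wordDiff_comp (p : ℕ) : wordDiff G n k (p + 1) ≫ wordDiff G n k p = 0 :=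
  Rep.hom_ext (Representation.IntertwiningMap.ext
    (LinearMap.ext fun x => wordDiffLinear_wordDiffLinear x))

lemma wordDiff_exact {p : ℕ} (hp : p + 1 < n) :
    (ShortComplex.mk _ _ (wordDiff_comp (G := G) (n := n) (k := k) p)).Exact := by
  rw [groupHomology.exact_iff]
  intro (x : Word G n (p + 1) →₀ k) (hx : wordDiffLinear G n k p x = 0)
  exact exists_wordDiffLinear_eq hp x (by rw [diff_lmapDomain_toList, hx, map_zero])

lemma epi_wordDiff_zero (hn : 0 < n) : Epi (wordDiff G n k 0) := by
  rw [Rep.epi_iff_surjective]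
  intro (x : Word G n 0 →₀ k)
  refine exists_wordDiffLinear_eq hn x ?_
  induction x using Finsupp.induction_linear with
  | zero => simp
  | add x y hx hy => simp only [map_add, hx, hy, add_zero]
  | single w c =>
    rw [lmapDomain_apply, mapDomain_single, InjectiveWord.diff_single,
      List.eq_nil_of_length_eq_zero w.length_eq]
    simp [InjectiveWord.deletions]

end Exactness

/-! ### The differential on homology -/

section Homology

lemma incl_fixes_base {p : ℕ} (hp : p ≤ n) (a : WreathSymm G (n - p)) :
    (wordRep G n k p).ρ (incl G (Nat.sub_le n p) a) (single (Word.base G hp) 1) =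
      single (Word.base G hp) 1 := by
  rw [wordRep_ρ_single, Word.incl_smul_base]

variable (G k) in
/-- The homology of `G ≀ S_{n-p}` mapped to that of `G ≀ S_n` with coefficients in the words of
length `p`. -/
noncomputable abbrev shapiro {p : ℕ} (hp : p ≤ n) (q : ℕ) :
    groupHomology (Rep.trivial k (WreathSymm G (n - p)) k) q ⟶
      groupHomology (wordRep G n k p) q :=
  groupHomology.map (incl G (Nat.sub_le n p)) (fixedHom (incl G (Nat.sub_le n p)) (wordRep G n k p)
    (single (Word.base G hp) 1) (incl_fixes_base hp)) q

lemma isIso_shapiro {p : ℕ} (hp : p ≤ n) (q : ℕ) : IsIso (shapiro G k hp q) :=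
  isIso_map_fixedHom (incl_injective _) (Word.base G hp) (Word.incl_smul_base hp)
    (Word.mem_range_incl_of_smul_base hp) (Word.exists_smul_base hp) q _

variable (G k) in
/-- The map on homology with trivial coefficients induced by `G ≀ S_a → G ≀ S_b`. -/
noncomputable abbrev inclMap {a b : ℕ} (h : a ≤ b) (q : ℕ) :
    groupHomology (Rep.trivial k (WreathSymm G a) k) q ⟶
      groupHomology (Rep.trivial k (WreathSymm G b) k) q :=
  groupHomology.map (B := Rep.trivial k (WreathSymm G b) k) (incl G h)
    (𝟙 (Rep.trivial k (WreathSymm G a) k)) q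

/-- The base word maps to the alternating sum of its p+1 faces. Each face is a translate of the
shorter base word by an element centralizing W_{n-p-1}, so all of them induce the same map:
stabilization followed by the Shapiro map. -/
lemma shapiro_comp_wordDiff {p : ℕ} (hp : p + 1 ≤ n) (q : ℕ) :
    shapiro G k hp q ≫ (functor k (WreathSymm G n) q).map (wordDiff G n k p) =
      if Even (p + 1) then 0 else
        inclMap G k (Nat.sub_le_sub_left p.le_succ n) q ≫ shapiro G k (p.le_succ.trans hp) q := by
  set j := incl G (Nat.sub_le n (p + 1)) with hj
  have hface : ∀ i < p + 1, ∀ a, j a • (Word.base G hp).erase i = (Word.base G hp).erase i :=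
    fun i _ a => by rw [← Word.smul_erase, Word.incl_smul_base]
  have hy : ∀ i < p + 1, ∀ a, (wordRep G n k p).ρ (j a) (single ((Word.base G hp).erase i) 1) =
      single ((Word.base G hp).erase i) 1 := fun i hi a => by
    rw [wordRep_ρ_single, hface i hi]
  have hincl : ∀ a, incl G (Nat.sub_le n p) (incl G (Nat.sub_le_sub_left p.le_succ n) a) = j a :=
    fun a => incl_incl _ _ a
  have hbase : ∀ a, (wordRep G n k p).ρ (j a) (single (Word.base G (p.le_succ.trans hp)) 1) =
      single (Word.base G (p.le_succ.trans hp)) 1 := fun a => by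
    rw [← hincl, incl_fixes_base]
  have hz : ∀ a, (wordRep G n k p).ρ (j a) (faces k (Word.base G hp)) =
      faces k (Word.base G hp) := fun a => by
    simp only [faces, map_sum, map_smul]
    exact Finset.sum_congr rfl fun i hi => by rw [hy i (Finset.mem_range.1 hi)]
  have e1 : wordDiffLinear G n k p (single (Word.base G hp) 1) = faces k (Word.base G hp) := by
    rw [wordDiffLinear_single, one_smul]
  refine (map_fixedHom_comp_functor_map j (wordDiff G n k p) _ _ _ hz e1 q).trans ?_
  refine map_fixedHom_alternating_sum j (wordRep G n k p)
    (fun i => single ((Word.base G hp).erase i) 1) (p + 1) q hy _ (fun i hi => ?_) _ hz rfl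
  obtain ⟨b, hb, hb'⟩ := Word.exists_erase_base_eq (G := G) hp i hi
  rw [map_fixedHom_conj j (wordRep G n k p) _ hbase b hb _ (hy i hi) (by
    rw [hb', wordRep_ρ_single])]
  exact (map_trivial_comp_map_fixedHom _ _ j hincl (wordRep G n k p) _ _ hbase q).symm

lemma map_wordDiff_eq_zero {p : ℕ} (hp : p + 1 ≤ n) (hodd : Odd p) (q : ℕ) :
    (functor k (WreathSymm G n) q).map (wordDiff G n k p) = 0 := by
  have := isIso_shapiro (G := G) (k := k) hp q
  have h := shapiro_comp_wordDiff (G := G) (k := k) hp q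
  rw [if_pos (by simpa [Nat.even_add_one] using hodd)] at h
  exact (cancel_epi (shapiro G k hp q)).1 (h.trans Limits.comp_zero.symm)

lemma isIso_map_wordDiff_iff {p : ℕ} (hp : p + 1 ≤ n) (heven : Even p) (q : ℕ) :
    IsIso ((functor k (WreathSymm G n) q).map (wordDiff G n k p)) ↔
      IsIso (inclMap G k (Nat.sub_le_sub_left p.le_succ n) q) := by
  have h1 := isIso_shapiro (G := G) (k := k) hp q
  have h2 := isIso_shapiro (G := G) (k := k) (p.le_succ.trans hp) q
  have h := shapiro_comp_wordDiff (G := G) (k := k) hp q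
  rw [if_neg (by simpa [Nat.even_add_one] using heven)] at h
  refine (isIso_comp_left_iff (shapiro G k hp q) _).symm.trans ?_
  rw [h]
  exact @isIso_comp_right_iff _ _ _ _ _ _ _ h2

end Homology

end WreathSymm

/-! ### Long exact sequences and the induction on degree -/

namespace groupHomology

open CategoryTheory Finsupp groupHomology

variable {k W : Type u} [CommRing k] [Group W]

lemma epi_map_zero_of_epi {A B : Rep.{u} k W} (f : A ⟶ B) [Epi f] :
    Epi ((functor k W 0).map f) :=
  epi_map_0_of_epi f

/-- Injectivity of the next map in the long exact sequence kills the connecting map. -/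
lemma epi_map_g_of_mono {S : ShortComplex (Rep.{u} k W)} (hS : S.ShortExact) (q : ℕ)
    (h : Mono ((functor k W q).map S.f)) : Epi ((functor k W (q + 1)).map S.g) := by
  have hS' := map_chainsFunctor_shortExact hS
  have h0 : hS'.δ (q + 1) q rfl ≫ (functor k W q).map S.f = 0 := hS'.δ_comp (q + 1) q rfl
  have hδ : hS'.δ (q + 1) q rfl = 0 := h.right_cancellation _ _ (h0.trans Limits.zero_comp.symm)
  exact (hS'.homology_exact₃ (q + 1) q rfl).epi_f hδ

lemma mono_map_g_of_eq_zero {S : ShortComplex (Rep.{u} k W)} (hS : S.ShortExact) (q : ℕ)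
    (h : (functor k W q).map S.f = 0) : Mono ((functor k W q).map S.g) :=
  (mapShortComplex₂_exact hS q).mono_g h

end groupHomology

namespace WreathSymm

open CategoryTheory Finsupp groupHomology

variable (G : Type u) [Group G] (n : ℕ) (k : Type u) [CommRing k]

/-- The boundaries in the complex of injective words. -/
noncomputable abbrev boundaries (p : ℕ) : Rep.{u} k (WreathSymm G n) :=
  Limits.image (wordDiff G n k p)

/-- The inclusion of the boundaries. -/
noncomputable abbrev boundariesι (p : ℕ) : boundaries G n k p ⟶ wordRep G n k p :=
  Limits.image.ι (wordDiff G n k p)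

/-- The differential as a map onto the boundaries. -/
noncomputable abbrev toBoundaries (p : ℕ) : wordRep G n k (p + 1) ⟶ boundaries G n k p :=
  Limits.factorThruImage (wordDiff G n k p)

lemma toBoundaries_comp_boundariesι (p : ℕ) :
    toBoundaries G n k p ≫ boundariesι G n k p = wordDiff G n k p :=
  Limits.image.fac _

lemma boundariesι_comp_toBoundaries (p : ℕ) :
    boundariesι G n k (p + 1) ≫ toBoundaries G n k p = 0 := by
  rw [← cancel_epi (toBoundaries G n k (p + 1)), ← cancel_mono (boundariesι G n k p),
    Category.assoc, Category.assoc, toBoundaries_comp_boundariesι, ← Category.assoc,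
    toBoundaries_comp_boundariesι, wordDiff_comp, Limits.comp_zero, Limits.zero_comp]

/-- The sequence `Z_{p+1} → C_{p+1} → Z_p`. -/
noncomputable abbrev boundariesSequence (p : ℕ) : ShortComplex (Rep.{u} k (WreathSymm G n)) :=
  ShortComplex.mk _ _ (boundariesι_comp_toBoundaries G n k p)

variable {n}

/-- Exactness at C_{p+1} is unaffected by replacing C_{p+2} with its image and C_p with the
subobject Z_p. -/
lemma boundariesSequence_shortExact {p : ℕ} (hp : p + 1 < n) :
    (boundariesSequence G n k p).ShortExact where
  exact := by
    let φ : ShortComplex.mk _ _ (wordDiff_comp (G := G) (n := n) (k := k) p) ⟶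
        ShortComplex.mk (boundariesι G n k (p + 1)) (wordDiff G n k p) (by
          rw [← toBoundaries_comp_boundariesι, ← Category.assoc, boundariesι_comp_toBoundaries,
            Limits.zero_comp]) :=
      { τ₁ := toBoundaries G n k (p + 1), τ₂ := 𝟙 _, τ₃ := 𝟙 _ }
    let ψ : boundariesSequence G n k p ⟶
        ShortComplex.mk (boundariesι G n k (p + 1)) (wordDiff G n k p) (by
          rw [← toBoundaries_comp_boundariesι, ← Category.assoc, boundariesι_comp_toBoundaries,
            Limits.zero_comp]) :=
      { τ₁ := 𝟙 _, τ₂ := 𝟙 _, τ₃ := boundariesι G n k p }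
    have h1 := (ShortComplex.exact_iff_of_epi_of_isIso_of_mono φ).1 (wordDiff_exact hp)
    exact (ShortComplex.exact_iff_of_epi_of_isIso_of_mono ψ).2 h1
  mono_f := inferInstanceAs (Mono (Limits.image.ι _))
  epi_g := inferInstanceAs (Epi (Limits.factorThruImage _))

/-- Homological stability for the wreath products in degree `q`. -/
def StableInDegree (q : ℕ) : Prop :=
  -- Keeping a and b as variables lets this apply to `n - (p + 1)` and `n - p` without transport.
  ∀ a b (h : a ≤ b), b = a + 1 → 2 * q < b → IsIso (inclMap G k h q)

variable {G k}

lemma StableInDegree.isIso_map_wordDiff {q : ℕ} (hq : StableInDegree G k q) {p : ℕ} (hp : Even p)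
    (hlt : 2 * q + p < n) : IsIso ((functor k (WreathSymm G n) q).map (wordDiff G n k p)) :=
  (isIso_map_wordDiff_iff (by omega) hp q).2 (hq _ _ _ (by omega) (by omega))

/-- In both ranges H_q(C_{p+1}) → H_q(Z_p) is epi: for q = 0 by right exactness, otherwise by the
case q-1 with p+1, of opposite parity. For even p its composite to H_q(C_p) is an isomorphism by
stability, so both factors are. For odd p, stability for the even index p+1 makes H_q(Z_{p+1}) →
H_q(C_{p+1}) epi, so the next map, to H_q(Z_p), is both zero and epi. -/
lemma boundaries_homology (q : ℕ) (hq : ∀ r ≤ q, StableInDegree G k r) :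
    (∀ p, Odd p → 2 * q + p + 1 < n → Limits.IsZero (groupHomology (boundaries G n k p) q)) ∧
    (∀ p, Even p → 2 * q + p < n →
      Mono ((functor k (WreathSymm G n) q).map (boundariesι G n k p))) := by
  have hfac : ∀ p, (functor k (WreathSymm G n) q).map (toBoundaries G n k p) ≫
      (functor k (WreathSymm G n) q).map (boundariesι G n k p) =
        (functor k (WreathSymm G n) q).map (wordDiff G n k p) := fun p => by
    rw [← Functor.map_comp, toBoundaries_comp_boundariesι]
  have main : (∀ p, Odd p → 2 * q + p + 1 < n →
      Epi ((functor k (WreathSymm G n) q).map (toBoundaries G n k p))) ∧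
    (∀ p, Even p → 2 * q + p < n →
      Epi ((functor k (WreathSymm G n) q).map (toBoundaries G n k p))) := by
    cases q with
    | zero => exact ⟨fun p _ _ => epi_map_zero_of_epi _, fun p _ _ => epi_map_zero_of_epi _⟩
    | succ q =>
      obtain ⟨ih1, ih2⟩ := boundaries_homology q fun r hr => hq r (hr.trans q.le_succ)
      constructor
      · intro p hp hlt
        exact epi_map_g_of_mono (boundariesSequence_shortExact G k (by omega)) q
          (ih2 (p + 1) hp.add_one (by omega))
      · intro p hp hlt
        exact epi_map_g_of_mono (boundariesSequence_shortExact G k (by omega)) q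
          ⟨fun _ _ _ => (ih1 (p + 1) hp.add_one (by omega)).eq_of_tgt _ _⟩
  constructor
  · intro p hp hlt
    have hepi := main.1 p hp hlt
    have hiso := (hq q le_rfl).isIso_map_wordDiff (n := n) (p := p + 1) hp.add_one (by omega)
    rw [← hfac] at hiso
    have : Epi ((functor k (WreathSymm G n) q).map (boundariesι G n k (p + 1))) :=
      epi_of_epi ((functor k (WreathSymm G n) q).map (toBoundaries G n k (p + 1))) _
    have hzero : (functor k (WreathSymm G n) q).map (toBoundaries G n k p) = 0 := by
      rw [← cancel_epi ((functor k (WreathSymm G n) q).map (boundariesι G n k (p + 1))),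
        ← Functor.map_comp, boundariesι_comp_toBoundaries, Functor.map_zero, Limits.comp_zero]
    exact @Limits.IsZero.of_epi_eq_zero _ _ _ _ _ _ hepi hzero
  · intro p hp hlt
    have hepi := main.2 p hp hlt
    have hiso := (hq q le_rfl).isIso_map_wordDiff (n := n) hp hlt
    rw [← hfac] at hiso
    have hmono : Mono ((functor k (WreathSymm G n) q).map (toBoundaries G n k p)) :=
      mono_of_mono _ ((functor k (WreathSymm G n) q).map (boundariesι G n k p))
    have := isIso_of_mono_of_epi ((functor k (WreathSymm G n) q).map (toBoundaries G n k p))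
    have := IsIso.of_isIso_comp_left ((functor k (WreathSymm G n) q).map (toBoundaries G n k p))
      ((functor k (WreathSymm G n) q).map (boundariesι G n k p))
    infer_instance

variable (G k)

theorem stableInDegree (q : ℕ) : StableInDegree G k q := by
  induction q using Nat.strong_induction_on with
  | _ q ih =>
    intro a n hle hn hlt
    cases q with
    | zero => exact isIso_map_zero_trivial _
    | succ q =>
      obtain ⟨h1, h2⟩ := boundaries_homology (G := G) (k := k) (n := n) q
        fun r hr => ih r (Nat.lt_succ_of_le hr)
      have hepi : Epi ((functor k (WreathSymm G n) (q + 1)).map (toBoundaries G n k 0)) :=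
        epi_map_g_of_mono (boundariesSequence_shortExact G k (by omega)) q
          ⟨fun _ _ _ => (h1 1 odd_one (by omega)).eq_of_tgt _ _⟩
      have hepi' : Epi ((functor k (WreathSymm G n) (q + 1)).map (toBoundaries G n k 1)) :=
        epi_map_g_of_mono (boundariesSequence_shortExact G k (by omega)) q
          (h2 2 even_two (by omega))
      -- The vanishing of the differential C_2 → C_1 on homology needs no stability, so it is
      -- available in the new degree q+1.
      have hzero : (functor k (WreathSymm G n) (q + 1)).map (boundariesι G n k 1) = 0 := by
        rw [← cancel_epi ((functor k (WreathSymm G n) (q + 1)).map (toBoundaries G n k 1)),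
          ← Functor.map_comp, toBoundaries_comp_boundariesι, Limits.comp_zero]
        exact map_wordDiff_eq_zero (by omega) odd_one _
      have hmono : Mono ((functor k (WreathSymm G n) (q + 1)).map (toBoundaries G n k 0)) :=
        mono_map_g_of_eq_zero (boundariesSequence_shortExact G k (by omega)) _ hzero
      have hiso := isIso_of_mono_of_epi
        ((functor k (WreathSymm G n) (q + 1)).map (toBoundaries G n k 0))
      have := epi_wordDiff_zero (G := G) (k := k) (n := n) (by omega)
      have : Epi (boundariesι G n k 0) := by
        rw [← toBoundaries_comp_boundariesι] at this
        exact epi_of_epi (toBoundaries G n k 0) _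
      -- Z_0 is all of C_0, so the isomorphism onto the homology of Z_0 is one onto that of C_0.
      have : IsIso (boundariesι G n k 0) := isIso_of_mono_of_epi _
      have hd : IsIso ((functor k (WreathSymm G n) (q + 1)).map (wordDiff G n k 0)) := by
        rw [← toBoundaries_comp_boundariesι, Functor.map_comp]
        infer_instance
      obtain rfl : a = n - 1 := by omega
      exact (isIso_map_wordDiff_iff (by omega) Even.zero (q + 1)).1 hd

end WreathSymm

theorem mainTheorem2 (G : Type u) [Group G] (m n : ℕ) (hn : 2 * m < n) :
    CategoryTheory.IsIso
      (integralHomologyMap (WreathSymm.incl G (k := n - 1) (n := n) (Nat.sub_le n 1)) m) :=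
  WreathSymm.stableInDegree G (ULift.{u} ℤ) m (n - 1) n (Nat.sub_le n 1) (by omega) hn
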